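/- Let $\mathcal H=\ell^2(\mathbb Z;\mathbb C^2)$, write $\psi(x)=(\psi^{(0)}(x),\psi^{(1)}(x))^{T}$ for $\psi\in\mathcal H$, and let $$C(x)=\begin{pmatrix} a(x)&b(x)\\ c(x)&d(x)\end{pmatrix}\in U(2),\qquad x\in\mathbb Z .$$ Let $U=SC$ be the unitary operator on $\mathcal H$ where $(C\psi)(x)=C(x)\psi(x)$ and $(S\psi)(x)=(\psi^{(0)}(x+1),\psi^{(1)}(x-1))^{T}$; that is, $$(U\psi)(x)=\begin{pmatrix} a(x+1)&b(x+1)\\0&0\end{pmatrix}\psi(x+1)+\begin{pmatrix}0&0\\ c(x-1)&d(x-1)\end{pmatrix}\psi(x-1).$$ Let $\alpha,\beta,\gamma\in[0,2\pi)$, $p\in(0,1]$ and $q\in[0,1]$ with $p^2+q^2=1$, and put $$C_0=\begin{pmatrix} p e^{i\alpha}& q e^{i\beta}\\ -q e^{-i(\beta-\gamma)}& p e^{-i(\alpha-\gamma)}\end{pmatrix}.$$ Assume that there is $\delta>0$ with $|a(x)|\ge\delta$ for all $x\in\mathbb Z$ (no edge defect), and that there are $\rho,M>0$ with $$\|C(x)-C_0\|_\infty\le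 M e^{-\rho\sqrt{1+x^2}}\qquad\text{for all }x\in\mathbb Z,$$ where $\|A\|_\infty=\max_{j,k}|a_{jk}|$ for a $2\times2$ matrix $A=[a_{jk}]$. Let $\sigma_{ess}(U)=\sigma(U)\setminus\sigma_d(U)$, where $\sigma_d(U)$ is the set of eigenvalues of $U$ of finite multiplicity that are isolated points of $\sigma(U)$. Then $$\sigma_{ess}(U)=\{e^{i\theta}:\theta\in J_\gamma\},$$ where $$J_\gamma=\left[\arccos p+\tfrac{\gamma}{2},\ \pi-\arccos p+\tfrac{\gamma}{2}\right]\cup\left[\pi+\arccos p+\tfrac{\gamma}{2},\ 2\pi-\arccos p+\tfrac{\gamma}{2}\right].$$ Moreover, $U$ has no eigenvalue in $\sigma_{ess}(U)\setminus\mathcal T$, where $\mathcal T=\{e^{i\theta}\in\sigma_{ess}(U):\theta\in J_{\gamma,\mathcal T}\}$ and $$J_{\gamma,\mathcal T}=\left\{\arccos p+\tfrac{\gamma}{2},\ \pi-\arccos p+\tfrac{\gamma}{2},\ \pi+\arccos p+\tfrac{\gamma}{2},\ 2\pi-\arccos p+\tfrac{\gamma}{2}\right\}.$$ -/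

import Mathlib

noncomputable section

namespace QuantumWalk

/-- The one-site space `ℂ²` with its Euclidean norm; component `0` is the upper one. -/
abbrev Site : Type := EuclideanSpace ℂ (Fin 2)

/-- The space of states `ℓ²(ℤ; ℂ²)`. -/
abbrev State : Type := lp (fun _ : ℤ => Site) 2

theorem memlp_iff_summable_sq (f : ℤ → Site) :
    Memℓp f 2 ↔ Summable fun x => ‖f x‖ ^ 2 := by
  have h := memℓp_gen_iff (E := fun _ : ℤ => Site) (p := 2) (f := f) (by norm_num)
  simpa using h

theorem norm_sq_eq_tsum (ψ : State) : ‖ψ‖ ^ 2 = ∑' x, ‖ψ x‖ ^ 2 := by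
  have h := lp.norm_rpow_eq_tsum (E := fun _ : ℤ => Site) (p := 2) (by norm_num) ψ
  simpa using h

theorem summable_sq (ψ : State) : Summable fun x => ‖ψ x‖ ^ 2 :=
  (memlp_iff_summable_sq _).1 (lp.memℓp ψ)

theorem site_norm_sq (v : Site) : ‖v‖ ^ 2 = ‖v 0‖ ^ 2 + ‖v 1‖ ^ 2 := by
  simp [EuclideanSpace.norm_sq_eq, Fin.sum_univ_two]

theorem summable_comp_sq (ψ : State) (i : Fin 2) : Summable fun x => ‖ψ x i‖ ^ 2 := by
  refine (summable_sq ψ).of_nonneg_of_le (fun _ => by positivity) fun x => ?_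
  rw [site_norm_sq]
  fin_cases i
  · simp
  · simp

/-- The pointwise action `v ↦ A v` of a coin matrix on `ℂ²`. -/
def coinAct (A : Matrix.unitaryGroup (Fin 2) ℂ) (v : Site) : Site :=
  WithLp.toLp 2 ((A : Matrix (Fin 2) (Fin 2) ℂ).mulVec v.ofLp)

theorem norm_coinAct (A : Matrix.unitaryGroup (Fin 2) ℂ) (v : Site) :
    ‖coinAct A v‖ = ‖v‖ := by
  have hA : star (A : Matrix (Fin 2) (Fin 2) ℂ) * A = 1 := Matrix.UnitaryGroup.star_mul_self A
  have key : inner ℂ (coinAct A v) (coinAct A v) = inner ℂ v v := by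
    simp only [coinAct, EuclideanSpace.inner_eq_star_dotProduct]
    rw [dotProduct_comm, Matrix.star_mulVec, Matrix.dotProduct_mulVec, Matrix.vecMul_vecMul,
      ← Matrix.star_eq_conjTranspose, hA, Matrix.vecMul_one, dotProduct_comm]
  rw [@norm_eq_sqrt_re_inner ℂ, @norm_eq_sqrt_re_inner ℂ, key]

theorem coinAct_add (A : Matrix.unitaryGroup (Fin 2) ℂ) (v w : Site) :
    coinAct A (v + w) = coinAct A v + coinAct A w := by
  unfold coinAct
  rw [WithLp.ofLp_add, Matrix.mulVec_add, WithLp.toLp_add]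

theorem coinAct_smul (A : Matrix.unitaryGroup (Fin 2) ℂ) (c : ℂ) (v : Site) :
    coinAct A (c • v) = c • coinAct A v := by
  unfold coinAct
  rw [WithLp.ofLp_smul, Matrix.mulVec_smul, WithLp.toLp_smul]

theorem coinAct_coinAct (A B : Matrix.unitaryGroup (Fin 2) ℂ) (v : Site) :
    coinAct A (coinAct B v) = coinAct (A * B) v := by
  unfold coinAct
  rw [Matrix.mulVec_mulVec, Matrix.UnitaryGroup.mul_val]

theorem coinAct_one (v : Site) : coinAct 1 v = v := by
  unfold coinAct
  rw [Matrix.UnitaryGroup.one_val, Matrix.one_mulVec]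

/-- The shift with step `s`: `(ψ⁽⁰⁾(x + s), ψ⁽¹⁾(x - s))`, as a map on functions. -/
def shiftFun (s : ℤ) (f : ℤ → Site) : ℤ → Site := fun x => !₂[f (x + s) 0, f (x - s) 1]

theorem norm_shiftFun_sq (s : ℤ) (f : ℤ → Site) (x : ℤ) :
    ‖shiftFun s f x‖ ^ 2 = ‖f (x + s) 0‖ ^ 2 + ‖f (x - s) 1‖ ^ 2 := by
  simp [site_norm_sq, shiftFun]

theorem summable_plus (s : ℤ) (ψ : State) : Summable fun x => ‖ψ (x + s) 0‖ ^ 2 :=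
  (Equiv.addRight s).summable_iff (f := fun x => ‖ψ x 0‖ ^ 2) |>.2 (summable_comp_sq ψ 0)

theorem summable_minus (s : ℤ) (ψ : State) : Summable fun x => ‖ψ (x - s) 1‖ ^ 2 :=
  (Equiv.subRight s).summable_iff (f := fun x => ‖ψ x 1‖ ^ 2) |>.2 (summable_comp_sq ψ 1)

theorem memlp_shiftFun (s : ℤ) (ψ : State) : Memℓp (shiftFun s ψ) 2 := by
  rw [memlp_iff_summable_sq]
  simp only [norm_shiftFun_sq]
  exact (summable_plus s ψ).add (summable_minus s ψ)

theorem memlp_coin (C : ℤ → Matrix.unitaryGroup (Fin 2) ℂ) (ψ : State) :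
    Memℓp (fun x => coinAct (C x) (ψ x)) 2 := by
  rw [memlp_iff_summable_sq]
  simpa only [norm_coinAct] using summable_sq ψ

/-- The multiplication operator `(C ψ)(x) = C(x) ψ(x)` on `ℓ²(ℤ; ℂ²)`. -/
def coinOp (C : ℤ → Matrix.unitaryGroup (Fin 2) ℂ) : State ≃ₗᵢ[ℂ] State where
  toFun ψ := ⟨fun x => coinAct (C x) (ψ x), memlp_coin C ψ⟩
  invFun ψ := ⟨fun x => coinAct (C x)⁻¹ (ψ x), memlp_coin (fun x => (C x)⁻¹) ψ⟩
  map_add' ψ φ := Subtype.ext (funext fun x => coinAct_add (C x) (ψ x) (φ x))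
  map_smul' c ψ := Subtype.ext (funext fun x => coinAct_smul (C x) c (ψ x))
  left_inv ψ := Subtype.ext (funext fun x => by
    change coinAct (C x)⁻¹ (coinAct (C x) (ψ x)) = ψ x
    rw [coinAct_coinAct, inv_mul_cancel, coinAct_one])
  right_inv ψ := Subtype.ext (funext fun x => by
    change coinAct (C x) (coinAct (C x)⁻¹ (ψ x)) = ψ x
    rw [coinAct_coinAct, mul_inv_cancel, coinAct_one])
  norm_map' ψ := by
    rw [← sq_eq_sq₀ (norm_nonneg _) (norm_nonneg _), norm_sq_eq_tsum, norm_sq_eq_tsum]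
    exact tsum_congr fun x => congrArg (· ^ 2) (norm_coinAct (C x) (ψ x))

/-- The shift operator `(S ψ)(x) = (ψ⁽⁰⁾(x + 1), ψ⁽¹⁾(x - 1))` on `ℓ²(ℤ; ℂ²)`. -/
def shiftOp : State ≃ₗᵢ[ℂ] State where
  toFun ψ := ⟨shiftFun 1 ψ, memlp_shiftFun 1 ψ⟩
  invFun ψ := ⟨shiftFun (-1) ψ, memlp_shiftFun (-1) ψ⟩
  map_add' ψ φ := Subtype.ext (funext fun x => by
    change shiftFun 1 (⇑ψ + ⇑φ) x = shiftFun 1 ψ x + shiftFun 1 φ x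
    ext i
    fin_cases i <;> simp [shiftFun])
  map_smul' c ψ := by
    ext x i
    fin_cases i <;> simp [shiftFun]
  left_inv ψ := by
    ext x i
    fin_cases i <;> simp [shiftFun]
  right_inv ψ := by
    ext x i
    fin_cases i <;> simp [shiftFun]
  norm_map' ψ := by
    rw [← sq_eq_sq₀ (norm_nonneg _) (norm_nonneg _), norm_sq_eq_tsum, norm_sq_eq_tsum]
    have h1 : ∑' x, ‖ψ (x + 1) 0‖ ^ 2 = ∑' x, ‖ψ x 0‖ ^ 2 :=
      (Equiv.addRight (1 : ℤ)).tsum_eq fun x => ‖ψ x 0‖ ^ 2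
    have h2 : ∑' x, ‖ψ (x - 1) 1‖ ^ 2 = ∑' x, ‖ψ x 1‖ ^ 2 :=
      (Equiv.subRight (1 : ℤ)).tsum_eq fun x => ‖ψ x 1‖ ^ 2
    calc ∑' x, ‖shiftFun 1 ψ x‖ ^ 2
        = ∑' x, (‖ψ (x + 1) 0‖ ^ 2 + ‖ψ (x - 1) 1‖ ^ 2) :=
          tsum_congr fun x => norm_shiftFun_sq 1 ψ x
      _ = ∑' x, (‖ψ x 0‖ ^ 2 + ‖ψ x 1‖ ^ 2) := by
          rw [(summable_plus 1 ψ).tsum_add (summable_minus 1 ψ), h1, h2,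
            (summable_comp_sq ψ 0).tsum_add (summable_comp_sq ψ 1)]
      _ = ∑' x, ‖ψ x‖ ^ 2 := tsum_congr fun x => (site_norm_sq (ψ x)).symm

/-- The time evolution operator `U = S C` of the quantum walk, a unitary operator. -/
def evolution (C : ℤ → Matrix.unitaryGroup (Fin 2) ℂ) : State ≃ₗᵢ[ℂ] State :=
  (coinOp C).trans shiftOp

/-- `U` as a bounded operator on `ℓ²(ℤ; ℂ²)`. -/
def evolutionCLM (C : ℤ → Matrix.unitaryGroup (Fin 2) ℂ) : State →L[ℂ] State :=
  (evolution C).toContinuousLinearEquiv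

/-- The formula `(U ψ)(x) = P(x + 1) ψ(x + 1) + Q(x - 1) ψ(x - 1)`, where `P` and `Q` are the
upper and the lower row of the coin. -/
theorem evolutionCLM_apply (C : ℤ → Matrix.unitaryGroup (Fin 2) ℂ) (ψ : State) (x : ℤ) :
    (evolutionCLM C ψ x).ofLp =
      (!![C (x + 1) 0 0, C (x + 1) 0 1; 0, 0] : Matrix (Fin 2) (Fin 2) ℂ).mulVec
          (ψ (x + 1)).ofLp +
        (!![0, 0; C (x - 1) 1 0, C (x - 1) 1 1] : Matrix (Fin 2) (Fin 2) ℂ).mulVec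
          (ψ (x - 1)).ofLp := by
  ext i
  fin_cases i <;>
    simp [evolutionCLM, evolution, coinOp, shiftOp, shiftFun, coinAct, Matrix.mulVec_eq_sum,
      Fin.sum_univ_two]

section Spectrum

variable {H : Type*} [NormedAddCommGroup H] [InnerProductSpace ℂ H]

/-- `z` is an eigenvalue of the bounded operator `T`. -/
def IsEigenvalue (T : H →L[ℂ] H) (z : ℂ) : Prop :=
  Module.End.HasEigenvalue (T : H →ₗ[ℂ] H) z

/-- The discrete spectrum: eigenvalues of finite multiplicity that are isolated points of
the spectrum. -/
def discreteSpectrum (T : H →L[ℂ] H) : Set ℂ :=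
  {z | IsEigenvalue T z ∧
    FiniteDimensional ℂ (Module.End.eigenspace (T : H →ₗ[ℂ] H) z) ∧
    ∃ ε : ℝ, 0 < ε ∧ ∀ w ∈ spectrum ℂ T, dist w z < ε → w = z}

/-- The essential spectrum (of a unitary operator): the spectrum without the discrete one. -/
def essentialSpectrum (T : H →L[ℂ] H) : Set ℂ := spectrum ℂ T \ discreteSpectrum T

end Spectrum

/-- The position-independent coin `C₀`. -/
def limitCoin (p q α β γ : ℝ) : Matrix (Fin 2) (Fin 2) ℂ :=
  !![(p : ℂ) * Complex.exp (Complex.I * α), (q : ℂ) * Complex.exp (Complex.I * β);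
    -(q : ℂ) * Complex.exp (-Complex.I * (β - γ)), (p : ℂ) * Complex.exp (-Complex.I * (α - γ))]

/-- The norm `max |a_jk|` of a `2 × 2` matrix. -/
def maxNorm (A : Matrix (Fin 2) (Fin 2) ℂ) : ℝ :=
  max (max ‖A 0 0‖ ‖A 0 1‖) (max ‖A 1 0‖ ‖A 1 1‖)

/-- The set of angles `J_γ`, a union of two closed intervals. -/
def arcAngles (p γ : ℝ) : Set ℝ :=
  Set.Icc (Real.arccos p + γ / 2) (Real.pi - Real.arccos p + γ / 2) ∪
    Set.Icc (Real.pi + Real.arccos p + γ / 2) (2 * Real.pi - Real.arccos p + γ / 2)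

/-- The set of threshold angles `J_{γ,𝒯}`: the endpoints of the two intervals of `J_γ`. -/
def thresholdAngles (p γ : ℝ) : Set ℝ :=
  {Real.arccos p + γ / 2, Real.pi - Real.arccos p + γ / 2,
    Real.pi + Real.arccos p + γ / 2, 2 * Real.pi - Real.arccos p + γ / 2}

/-- The set of thresholds `𝒯 = {e^{iθ} ∈ σ_ess(U) : θ ∈ J_{γ,𝒯}}`. -/
def thresholds (C : ℤ → Matrix.unitaryGroup (Fin 2) ℂ) (p γ : ℝ) : Set ℂ :=
  {z ∈ essentialSpectrum (evolutionCLM C) |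
    ∃ θ ∈ thresholdAngles p γ, z = Complex.exp (Complex.I * θ)}

end QuantumWalk

end

/-!
Write `A = C₀` for the limit coin, `a`, `d` for its diagonal entries (of modulus `p`) and
`U₀` for the walk with the constant coin `A`.

The constant walk satisfies the Cayley–Hamilton identity `U₀² + det A = (a τ + d τ⁻¹) U₀`, where
`τ` is the translation (`evolutionCLM_const_cayleyHamilton`). The right-hand side has norm at most
`2 p ‖ψ‖`, so `U₀ - z` is bounded below if `|z| = 1` and `|z² + det A| > 2 p`. With
`det A = e^{iγ}` and `z = e^{iθ}` one has `|z² + det A| = 2 |cos (θ - γ / 2)|`, so this is the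
complement of the arcs in the unit circle (`exists_arcAngle_iff`). No Fourier transform is needed.

*The essential spectrum lies in the arcs.* `U - U₀` is compact, since the coins converge. Hence,
where `U₀ - z` is bounded below, bounded sequences of approximate eigenvectors of `U` for `z` have
convergent subsequences, and a spectral point `z` of the unitary operator `U` is then an isolated
eigenvalue of finite multiplicity (`mem_discreteSpectrum_of_compact`).

*The arcs lie in the essential spectrum.* On the arcs the dispersion relation
`a κ² - (z + det A / z) κ + d = 0` has roots `κ`, `κ'` of modulus `1` (`exists_waveNumbers`).
Wave packets `κ ^ x u` cut off to long intervals far from the origin are approximate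
eigenvectors of `U` (`mem_spectrum_of_dispersion`). The arcs have no isolated points, so none of
their points is in the discrete spectrum.

*No eigenvalues inside the arcs.* Away from the thresholds `κ ≠ κ'`, so the transfer matrix of `U₀`
is an isometry in a suitable norm. The transfer matrices of `U` differ from it by a summable error,
hence a solution of `U ψ = z ψ` that decays at `+∞` vanishes at some site, and then everywhere,
because without edge defects the transfer matrices are invertible
(`not_isEigenvalue_of_dispersion`).
-/

open Filter Topology

noncomputable section

namespace QuantumWalk

/-! ### Spectra of unitary operators -/

section Abstract

variable {H : Type*} [NormedAddCommGroup H] [InnerProductSpace ℂ H]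

theorem isEigenvalue_iff {T : H →L[ℂ] H} {z : ℂ} :
    IsEigenvalue T z ↔ ∃ v, v ≠ 0 ∧ T v = z • v := by
  constructor
  · intro h
    obtain ⟨v, hv⟩ := Module.End.HasEigenvalue.exists_hasEigenvector h
    exact ⟨v, hv.2, hv.apply_eq_smul⟩
  · rintro ⟨v, hv, h⟩
    exact Module.End.hasEigenvalue_of_hasEigenvector
      (Module.End.hasEigenvector_iff.2 ⟨Module.End.mem_eigenspace_iff.2 h, hv⟩)

/-- The Palais–Smale type condition at `z`: every bounded sequence of approximate eigenvectors
for `z` has a convergent subsequence. For a unitary operator it forces a spectral point `z` to be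
in the discrete spectrum. -/
def ApproxEigenvectorsCompact (T : H →L[ℂ] H) (z : ℂ) : Prop :=
  ∀ v : ℕ → H, (∀ n, ‖v n‖ ≤ 1) → Tendsto (fun n => T (v n) - z • v n) atTop (𝓝 0) →
    ∃ a, ∃ φ : ℕ → ℕ, StrictMono φ ∧ Tendsto (v ∘ φ) atTop (𝓝 a)

/-- A compact perturbation of an operator `T₀` with `T₀ - z` bounded below satisfies the
compactness condition at `z`. -/
theorem approxEigenvectorsCompact_of_compact_sub [CompleteSpace H] {T T₀ : H →L[ℂ] H} {z : ℂ}
    (hK : IsCompactOperator (T - T₀)) {c : ℝ} (hc : 0 < c)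
    (hbelow : ∀ v, c * ‖v‖ ≤ ‖T₀ v - z • v‖) : ApproxEigenvectorsCompact T z := by
  intro v hv hlim
  obtain ⟨S, hS, hsub⟩ := hK.image_closedBall_subset_compact 
    (f := ((T - T₀ : H →L[ℂ] H) : H →ₗ[ℂ] H)) 1
  obtain ⟨w, -, φ, hφ, hw⟩ := hS.tendsto_subseq (x := fun n => (T - T₀) (v n))
    fun n => hsub ⟨v n, by simpa using hv n, rfl⟩
  have hconv : Tendsto (fun n => T₀ (v (φ n)) - z • v (φ n)) atTop (𝓝 (0 - w)) := by
    refine ((hlim.comp hφ.tendsto_atTop).sub hw).congr fun n => ?_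
    simp only [Function.comp_apply, sub_apply]
    abel
  have hcau : CauchySeq (v ∘ φ) := by
    rw [Metric.cauchySeq_iff']
    intro ε hε
    obtain ⟨N, hN⟩ := Metric.cauchySeq_iff'.1 hconv.cauchySeq (c * ε) (by positivity)
    refine ⟨N, fun n hn => ?_⟩
    have h1 := hN n hn
    have h2 := hbelow (v (φ n) - v (φ N))
    rw [dist_eq_norm] at h1 ⊢
    have h3 : T₀ (v (φ n) - v (φ N)) - z • (v (φ n) - v (φ N)) =
        T₀ (v (φ n)) - z • v (φ n) - (T₀ (v (φ N)) - z • v (φ N)) := by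
      rw [map_sub, smul_sub]
      abel
    rw [h3] at h2
    exact lt_of_mul_lt_mul_left (h2.trans_lt h1) hc.le
  obtain ⟨a, ha⟩ := cauchySeq_tendsto_of_complete hcau
  exact ⟨a, φ, hφ, ha⟩

/-- An operator that is not bounded below at `z` has `z` in its spectrum. -/
theorem mem_spectrum_of_approx {T : H →L[ℂ] H} {z : ℂ}
    (h : ∀ ε > 0, ∃ v, ‖T v - z • v‖ < ε * ‖v‖) : z ∈ spectrum ℂ T := by
  rw [spectrum.mem_iff]
  rintro ⟨u, hu⟩
  set B : H →L[ℂ] H := ↑u⁻¹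
  obtain ⟨v, hv⟩ := h (‖B‖ + 1)⁻¹ (by positivity)
  have h1 : B (z • v - T v) = v := by
    have h2 : (z • v - T v) = (u : H →L[ℂ] H) v := by
      rw [hu]; simp [Algebra.algebraMap_eq_smul_one]
    rw [h2, ← mul_apply_eq_comp, Units.inv_mul, one_apply_eq_self]
  have h3 : ‖v‖ ≤ ‖B‖ * ‖T v - z • v‖ := by
    have h4 := B.le_opNorm (z • v - T v)
    rwa [h1, norm_sub_rev] at h4
  have h5 : (‖B‖ + 1) * ‖T v - z • v‖ < ‖v‖ := by
    rw [inv_mul_eq_div, lt_div_iff₀ (by positivity)] at hv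
    linarith
  nlinarith [norm_nonneg (T v - z • v)]

/-- Spectral points of a unitary operator are approximate eigenvalues: the adjoint of the normal
operator `T - z` has the same lower bound as `T - z`, so a lower bound makes it invertible. -/
theorem exists_approx_of_mem_spectrum [CompleteSpace H] {T : H →L[ℂ] H}
    (hT : T ∈ unitary (H →L[ℂ] H)) {z : ℂ} (hz : z ∈ spectrum ℂ T) {ε : ℝ} (hε : 0 < ε) :
    ∃ v, ‖v‖ = 1 ∧ ‖T v - z • v‖ < ε := by
  by_contra! hcon
  have hbelow : ∀ v, ε * ‖v‖ ≤ ‖T v - z • v‖ := by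
    intro v
    rcases eq_or_ne v 0 with rfl | hv
    · simp
    have hv' : ‖v‖ ≠ 0 := norm_ne_zero_iff.2 hv
    have h1 := hcon ((‖v‖⁻¹ : ℂ) • v) (by rw [norm_smul]; simp [hv'])
    rw [map_smul, smul_comm, ← smul_sub, norm_smul] at h1
    simp only [norm_inv, Complex.norm_real, norm_norm] at h1
    rwa [inv_mul_eq_div, le_div_iff₀ (by positivity)] at h1
  set A : H →L[ℂ] H := algebraMap ℂ (H →L[ℂ] H) z - T with hA
  have hAapp : ∀ v, A v = z • v - T v := fun v => by
    simp [hA, Algebra.algebraMap_eq_smul_one]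
  have hcomm : Commute (star A) A := by
    have h1 : star T * T = 1 := hT.1
    have h2 : T * star T = 1 := hT.2
    have h3 : Commute (star T) T := by rw [Commute, SemiconjBy, h1, h2]
    rw [hA, star_sub, ← algebraMap_star_comm]
    exact ((Algebra.commute_algebraMap_left _ _).sub_left
      ((Algebra.commute_algebraMap_right _ _).sub_right h3))
  have hunit : IsUnit (star A * A) := by
    refine ContinuousLinearMap.isUnit_of_forall_le_norm_inner_map _
      (c := ⟨ε ^ 2, by positivity⟩) (by exact_mod_cast (by positivity : 0 < ε ^ 2)) fun v => ?_
    have h1 : inner ℂ ((star A * A) v) v = ((‖A v‖ ^ 2 : ℝ) : ℂ) := by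
      rw [mul_apply_eq_comp, ContinuousLinearMap.star_eq_adjoint,
        ContinuousLinearMap.adjoint_inner_left, inner_self_eq_norm_sq_to_K]
      simp
    rw [h1, Complex.norm_real, Real.norm_of_nonneg (by positivity)]
    have h2 : ε * ‖v‖ ≤ ‖A v‖ := by rw [hAapp, norm_sub_rev]; exact hbelow v
    calc ‖v‖ ^ 2 * ε ^ 2 = (ε * ‖v‖) ^ 2 := by ring
      _ ≤ _ := by gcongr
  exact hz (hcomm.isUnit_mul_iff.1 hunit).2

theorem inner_map_map_of_unitary [CompleteSpace H] {T : H →L[ℂ] H}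
    (hT : T ∈ unitary (H →L[ℂ] H)) (v w : H) : inner ℂ (T v) (T w) = inner ℂ v w := by
  rw [← ContinuousLinearMap.adjoint_inner_right, ← ContinuousLinearMap.star_eq_adjoint,
    ← mul_apply_eq_comp, hT.1, one_apply_eq_self]

theorem norm_map_of_unitary [CompleteSpace H] {T : H →L[ℂ] H}
    (hT : T ∈ unitary (H →L[ℂ] H)) (v : H) : ‖T v‖ = ‖v‖ := by
  rw [@norm_eq_sqrt_re_inner ℂ, @norm_eq_sqrt_re_inner ℂ, inner_map_map_of_unitary hT]

/-- The limit of a convergent sequence of approximate eigenvectors is an eigenvector. -/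
theorem map_eq_smul_of_tendsto {T : H →L[ℂ] H} {z : ℂ} {v : ℕ → H} {a : H}
    (hv : Tendsto v atTop (𝓝 a)) (h : Tendsto (fun n => T (v n) - z • v n) atTop (𝓝 0)) :
    T a = z • a :=
  sub_eq_zero.1 (tendsto_nhds_unique
    (((T.continuous.tendsto a).comp hv).sub (hv.const_smul z)) h)

/-- Under the compactness condition, a spectral point of a unitary operator is an isolated
eigenvalue of finite multiplicity. It is isolated because eigenvectors of a unitary operator for
different eigenvalues are orthogonal, and approximately so for approximate eigenvectors. -/
theorem mem_discreteSpectrum_of_compact [CompleteSpace H] {T : H →L[ℂ] H}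
    (hT : T ∈ unitary (H →L[ℂ] H)) {z : ℂ} (hz : z ∈ spectrum ℂ T)
    (hcpt : ApproxEigenvectorsCompact T z) : z ∈ discreteSpectrum T := by
  refine ⟨?_, ?_, ?_⟩
  · choose v hv1 hv2 using fun n : ℕ =>
      exists_approx_of_mem_spectrum hT hz (ε := 1 / ((n : ℝ) + 1)) (by positivity)
    have hlim : Tendsto (fun n => T (v n) - z • v n) atTop (𝓝 0) :=
      squeeze_zero_norm (fun n => (hv2 n).le) tendsto_one_div_add_atTop_nhds_zero_nat
    obtain ⟨a, φ, hφ, ha⟩ := hcpt v (fun n => (hv1 n).le) hlim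
    refine isEigenvalue_iff.2 ⟨a, ?_, map_eq_smul_of_tendsto ha (hlim.comp hφ.tendsto_atTop)⟩
    have h1 : ‖a‖ = 1 := tendsto_nhds_unique ha.norm (by simp [hv1])
    exact norm_ne_zero_iff.1 (by rw [h1]; exact one_ne_zero)
  · set E := Module.End.eigenspace (T : H →ₗ[ℂ] H) z
    refine FiniteDimensional.of_isCompact_closedBall ℂ (V := E) (r := 1) one_pos (c := 0) ?_
    refine IsSeqCompact.isCompact fun v hv => ?_
    have heig : ∀ w : E, T w = z • (w : H) := fun w => Module.End.mem_eigenspace_iff.1 w.2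
    obtain ⟨a, φ, hφ, ha⟩ := hcpt (fun n => (v n : H)) (fun n => by simpa using hv n)
      (by simp [heig])
    have haE : a ∈ E := Module.End.mem_eigenspace_iff.2
      (map_eq_smul_of_tendsto ha (by simp [heig]))
    have hconv : Tendsto (v ∘ φ) atTop (𝓝 (⟨a, haE⟩ : E)) := tendsto_subtype_rng.2 ha
    exact ⟨⟨a, haE⟩, Metric.isClosed_closedBall.mem_of_tendsto hconv
      (Eventually.of_forall fun n => hv (φ n)), φ, hφ, hconv⟩
  · by_contra! hcon
    choose w hw hdist hne using fun n : ℕ => hcon (1 / ((n : ℝ) + 1)) (by positivity)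
    have hpos : ∀ n, 0 < ‖w n - z‖ / ((n : ℝ) + 1) := fun n =>
      div_pos (norm_pos_iff.2 (sub_ne_zero.2 (hne n))) (by positivity)
    -- The error is small relative to `‖w n - z‖`, as the orthogonality estimate divides by it.
    choose v hv1 hv2 using fun n => exists_approx_of_mem_spectrum hT (hw n) (hpos n)
    have hnw : ∀ n, ‖w n - z‖ ≤ 1 / ((n : ℝ) + 1) := fun n => by
      rw [← dist_eq_norm]; exact (hdist n).le
    have hle : ∀ n, ‖T (v n) - z • v n‖ ≤ 1 / ((n : ℝ) + 1) + 1 / ((n : ℝ) + 1) := by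
      intro n
      have h1 : T (v n) - z • v n = (T (v n) - w n • v n) + (w n - z) • v n := by
        rw [sub_smul]; abel
      have h2 : ‖w n - z‖ / ((n : ℝ) + 1) ≤ ‖w n - z‖ :=
        div_le_self (norm_nonneg _) (by linarith [(n.cast_nonneg : (0 : ℝ) ≤ n)])
      calc _ ≤ ‖T (v n) - w n • v n‖ + ‖(w n - z) • v n‖ := h1 ▸ norm_add_le _ _
        _ ≤ _ := by
          rw [norm_smul, hv1, mul_one]
          linarith [hv2 n, hnw n]
    have hlim : Tendsto (fun n => T (v n) - z • v n) atTop (𝓝 0) :=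
      squeeze_zero_norm hle (by
        simpa using (tendsto_one_div_add_atTop_nhds_zero_nat (𝕜 := ℝ)).add
          (tendsto_one_div_add_atTop_nhds_zero_nat (𝕜 := ℝ)))
    obtain ⟨a, φ, hφ, ha⟩ := hcpt v (fun n => (hv1 n).le) hlim
    have hTa : T a = z • a := map_eq_smul_of_tendsto ha (hlim.comp hφ.tendsto_atTop)
    have ha1 : ‖a‖ = 1 := tendsto_nhds_unique ha.norm (by simp [hv1])
    have hz1 : ‖z‖ = 1 := by
      have h1 := norm_map_of_unitary hT a
      rwa [hTa, norm_smul, ha1, mul_one] at h1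
    have horth : ∀ n, ‖inner ℂ a (v n)‖ ≤ 1 / ((n : ℝ) + 1) := by
      intro n
      have h1 : inner ℂ (T a) (T (v n) - w n • v n) =
          (1 - w n * star z) * inner ℂ a (v n) := by
        rw [inner_sub_right, inner_map_map_of_unitary hT, inner_smul_right, hTa, inner_smul_left]
        simp
        ring
      have h2 : ‖1 - w n * star z‖ = ‖w n - z‖ := by
        have h3 : (1 : ℂ) = z * star z := by
          rw [Complex.star_def, Complex.mul_conj, Complex.normSq_eq_norm_sq, hz1]; simp
        rw [h3, ← sub_mul, norm_mul, norm_star, hz1, mul_one, norm_sub_rev]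
      have h4 := norm_inner_le_norm (𝕜 := ℂ) (T a) (T (v n) - w n • v n)
      rw [h1, norm_mul, h2, norm_map_of_unitary hT, ha1, one_mul] at h4
      have h5 := h4.trans (hv2 n).le
      rw [div_eq_mul_one_div] at h5
      exact le_of_mul_le_mul_left h5 (norm_pos_iff.2 (sub_ne_zero.2 (hne n)))
    have h1 : Tendsto (fun n => inner ℂ a (v (φ n))) atTop (𝓝 (inner ℂ a a)) :=
      tendsto_const_nhds.inner ha
    have h2 : Tendsto (fun n => inner ℂ a (v (φ n))) atTop (𝓝 0) :=
      (squeeze_zero_norm horth tendsto_one_div_add_atTop_nhds_zero_nat).comp hφ.tendsto_atTop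
    have h3 := tendsto_nhds_unique h1 h2
    rw [inner_self_eq_zero] at h3
    simp [h3] at ha1

end Abstract

/-! ### The arcs on the unit circle -/

theorem norm_exp_sq_add_exp (t γ : ℝ) :
    ‖Complex.exp (Complex.I * (t + γ / 2 : ℝ)) ^ 2 + Complex.exp (Complex.I * γ)‖ =
      2 * |Real.cos t| := by
  have h : Complex.exp (Complex.I * (t + γ / 2 : ℝ)) ^ 2 + Complex.exp (Complex.I * γ) =
      Complex.exp (Complex.I * (t + γ : ℝ)) * (2 * Real.cos t : ℝ) := by
    rw [Complex.ofReal_mul, Complex.ofReal_ofNat, Complex.ofReal_cos, Complex.two_cos, mul_add,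
      ← Complex.exp_nat_mul, ← Complex.exp_add, ← Complex.exp_add]
    congr 2 <;> push_cast <;> ring
  rw [h, norm_mul, Complex.norm_exp_I_mul_ofReal, one_mul, Complex.norm_real, Real.norm_eq_abs,
    abs_mul, abs_two]

theorem abs_cos_le_iff {p s : ℝ} (hp : 0 ≤ p) (hp1 : p ≤ 1) (hs : s ∈ Set.Icc 0 Real.pi) :
    |Real.cos s| ≤ p ↔ s ∈ Set.Icc (Real.arccos p) (Real.pi - Real.arccos p) := by
  have h1 : Real.cos s ≤ p ↔ Real.arccos p ≤ s := by
    conv_rhs => rw [← Real.arccos_cos hs.1 hs.2]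
    exact (Real.strictAntiOn_arccos.le_iff_ge ⟨by linarith, hp1⟩
      ⟨Real.neg_one_le_cos s, Real.cos_le_one s⟩).symm
  have h2 : -p ≤ Real.cos s ↔ s ≤ Real.pi - Real.arccos p := by
    rw [← Real.arccos_neg]
    conv_rhs => rw [← Real.arccos_cos hs.1 hs.2]
    exact (Real.strictAntiOn_arccos.le_iff_ge ⟨Real.neg_one_le_cos s, Real.cos_le_one s⟩
      ⟨by linarith, by linarith⟩).symm
  rw [abs_le, Set.mem_Icc, h1, h2, and_comm]

theorem abs_cos_eq_imp {p s : ℝ} (hs : s ∈ Set.Icc 0 Real.pi) (h : |Real.cos s| = p) :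
    s = Real.arccos p ∨ s = Real.pi - Real.arccos p := by
  rw [← h]
  rcases abs_choice (Real.cos s) with h1 | h1 <;> rw [h1]
  · left; rw [Real.arccos_cos hs.1 hs.2]
  · right; rw [Real.arccos_neg, Real.arccos_cos hs.1 hs.2]; ring

/-- A point of the unit circle is `e^{i(t + γ/2)}` with `t` in the upper half `[0, π]`, or shifted
from there by `π`. -/
theorem exists_angle {z : ℂ} (hz : ‖z‖ = 1) (γ : ℝ) :
    ∃ s ∈ Set.Icc 0 Real.pi, z = Complex.exp (Complex.I * (s + γ / 2 : ℝ)) ∨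
      z = Complex.exp (Complex.I * (Real.pi + s + γ / 2 : ℝ)) := by
  set r := toIcoMod Real.two_pi_pos 0 (Complex.arg z - γ / 2)
  have hr : r ∈ Set.Ico 0 (0 + 2 * Real.pi) := toIcoMod_mem_Ico _ _ _
  have hz' : z = Complex.exp (Complex.I * (r + γ / 2 : ℝ)) := by
    have h1 : r + γ / 2 = Complex.arg z -
        toIcoDiv Real.two_pi_pos 0 (Complex.arg z - γ / 2) * (2 * Real.pi) := by
      simp only [r, toIcoMod, zsmul_eq_mul]; ring
    have h2 : Complex.I * (r + γ / 2 : ℝ) = Complex.arg z * Complex.I -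
        toIcoDiv Real.two_pi_pos 0 (Complex.arg z - γ / 2) * (2 * Real.pi * Complex.I) := by
      rw [h1]; push_cast; ring
    rw [h2, Complex.exp_sub, Complex.exp_int_mul_two_pi_mul_I, div_one]
    have h3 := Complex.norm_mul_exp_arg_mul_I z
    rw [hz] at h3
    simpa using h3.symm
  rcases le_total r Real.pi with h | h
  · exact ⟨r, ⟨hr.1, h⟩, Or.inl hz'⟩
  · refine ⟨r - Real.pi, ⟨by linarith, by linarith [hr.2]⟩, Or.inr ?_⟩
    rw [hz']; congr 3; ring

theorem norm_exp_pi_sq_add_exp (s γ : ℝ) :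
    ‖Complex.exp (Complex.I * (Real.pi + s + γ / 2 : ℝ)) ^ 2 + Complex.exp (Complex.I * γ)‖ =
      2 * |Real.cos s| := by
  rw [norm_exp_sq_add_exp, add_comm Real.pi s, Real.cos_add_pi, abs_neg]

/-- The arcs in terms of the symbol of the walk: with `e^{iγ} = det C₀`, the condition
`|z² + det C₀| ≤ 2 p` says that the dispersion relation has a real wave number. -/
theorem exists_arcAngle_iff {p γ : ℝ} (hp : 0 < p) (hp1 : p ≤ 1) (z : ℂ) :
    (∃ θ ∈ arcAngles p γ, z = Complex.exp (Complex.I * θ)) ↔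
      ‖z‖ = 1 ∧ ‖z ^ 2 + Complex.exp (Complex.I * γ)‖ ≤ 2 * p := by
  have h0 := Real.arccos_nonneg p
  constructor
  · rintro ⟨θ, hθ, rfl⟩
    refine ⟨Complex.norm_exp_I_mul_ofReal θ, ?_⟩
    rcases hθ with hθ | hθ
    · obtain ⟨s, rfl⟩ : ∃ s, θ = s + γ / 2 := ⟨θ - γ / 2, by ring⟩
      rw [norm_exp_sq_add_exp]
      have hs : s ∈ Set.Icc (Real.arccos p) (Real.pi - Real.arccos p) :=
        ⟨by linarith [hθ.1], by linarith [hθ.2]⟩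
      have h1 := (abs_cos_le_iff hp.le hp1 ⟨by linarith [hs.1], by linarith [hs.2]⟩).2 hs
      linarith
    · obtain ⟨s, rfl⟩ : ∃ s, θ = Real.pi + s + γ / 2 := ⟨θ - γ / 2 - Real.pi, by ring⟩
      rw [norm_exp_pi_sq_add_exp]
      have hs : s ∈ Set.Icc (Real.arccos p) (Real.pi - Real.arccos p) :=
        ⟨by linarith [hθ.1], by linarith [hθ.2]⟩
      have h1 := (abs_cos_le_iff hp.le hp1 ⟨by linarith [hs.1], by linarith [hs.2]⟩).2 hs
      linarith
  · rintro ⟨hz, hle⟩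
    obtain ⟨s, hs, rfl | rfl⟩ := exists_angle hz γ
    · rw [norm_exp_sq_add_exp] at hle
      have h1 := (abs_cos_le_iff hp.le hp1 hs).1 (by linarith)
      exact ⟨_, Or.inl ⟨by linarith [h1.1], by linarith [h1.2]⟩, rfl⟩
    · rw [norm_exp_pi_sq_add_exp] at hle
      have h1 := (abs_cos_le_iff hp.le hp1 hs).1 (by linarith)
      exact ⟨_, Or.inr ⟨by linarith [h1.1], by linarith [h1.2]⟩, rfl⟩

theorem exists_thresholdAngle {p γ : ℝ} {z : ℂ} (hz : ‖z‖ = 1)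
    (h : ‖z ^ 2 + Complex.exp (Complex.I * γ)‖ = 2 * p) :
    ∃ θ ∈ thresholdAngles p γ, z = Complex.exp (Complex.I * θ) := by
  obtain ⟨s, hs, rfl | rfl⟩ := exists_angle hz γ
  · rw [norm_exp_sq_add_exp] at h
    refine ⟨_, ?_, rfl⟩
    rcases abs_cos_eq_imp hs (by linarith) with rfl | rfl <;> simp [thresholdAngles]
  · rw [norm_exp_pi_sq_add_exp] at h
    refine ⟨_, ?_, rfl⟩
    rcases abs_cos_eq_imp hs (by linarith) with rfl | rfl
    · simp [thresholdAngles]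
    · simp only [thresholdAngles, Set.mem_insert_iff, Set.mem_singleton_iff]
      right; right; right; ring

/-- The arcs have no isolated points; they are nondegenerate because `arccos p < π / 2`. -/
theorem exists_arcAngle_near {p γ θ : ℝ} (hp : 0 < p) (hθ : θ ∈ arcAngles p γ) {ε : ℝ}
    (hε : 0 < ε) : ∃ θ' ∈ arcAngles p γ,
      dist (Complex.exp (Complex.I * θ')) (Complex.exp (Complex.I * θ)) < ε ∧
        Complex.exp (Complex.I * θ') ≠ Complex.exp (Complex.I * θ) := by
  have hhalf : Real.arccos p < Real.pi / 2 := Real.arccos_lt_pi_div_two.2 hp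
  have key : ∀ l r : ℝ, l < r → θ ∈ Set.Icc l r →
      ∃ θ' ∈ Set.Icc l r, θ' ≠ θ ∧ |θ' - θ| < min ε 1 := by
    intro l r hlr hθ
    have hη : 0 < min ε 1 := lt_min hε one_pos
    rcases eq_or_lt_of_le hθ.2 with h | h
    · refine ⟨max l (θ - min ε 1 / 2), ⟨le_max_left _ _, ?_⟩, ?_, ?_⟩
      · exact max_le hlr.le (by linarith)
      · exact (max_lt (h ▸ hlr) (by linarith)).ne
      · rw [abs_sub_lt_iff]
        have := le_max_right l (θ - min ε 1 / 2)
        have : max l (θ - min ε 1 / 2) ≤ θ := max_le hθ.1 (by linarith)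
        constructor <;> linarith
    · refine ⟨min r (θ + min ε 1 / 2), ⟨?_, min_le_left _ _⟩, ?_, ?_⟩
      · exact le_min hlr.le (by linarith [hθ.1])
      · exact (lt_min h (by linarith)).ne'
      · rw [abs_sub_lt_iff]
        have := min_le_right r (θ + min ε 1 / 2)
        have : θ ≤ min r (θ + min ε 1 / 2) := le_min hθ.2 (by linarith)
        constructor <;> linarith
  -- A distance below `1`, hence below `2 π`, keeps the exponentials of `θ'` and `θ` apart.
  obtain ⟨θ', hmem, hne, hlt⟩ : ∃ θ' ∈ arcAngles p γ, θ' ≠ θ ∧ |θ' - θ| < min ε 1 := by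
    rcases hθ with hθ | hθ
    · obtain ⟨θ', h1, h2⟩ := key _ _ (by linarith) hθ
      exact ⟨θ', Or.inl h1, h2⟩
    · obtain ⟨θ', h1, h2⟩ := key _ _ (by linarith) hθ
      exact ⟨θ', Or.inr h1, h2⟩
  have hsub : ‖Complex.exp (Complex.I * θ') - Complex.exp (Complex.I * θ)‖ =
      ‖Complex.exp (Complex.I * (θ' - θ : ℝ)) - 1‖ := by
    have h1 : Complex.exp (Complex.I * θ') - Complex.exp (Complex.I * θ) =
        Complex.exp (Complex.I * θ) * (Complex.exp (Complex.I * (θ' - θ : ℝ)) - 1) := by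
      rw [mul_sub, ← Complex.exp_add, mul_one]
      congr 2; push_cast; ring
    rw [h1, norm_mul, Complex.norm_exp_I_mul_ofReal, one_mul]
  refine ⟨θ', hmem, ?_, ?_⟩
  · rw [dist_eq_norm, hsub]
    exact Real.norm_exp_I_mul_ofReal_sub_one_le.trans_lt (hlt.trans_le (min_le_left _ _))
  · rw [← sub_ne_zero, ← norm_ne_zero_iff, hsub, Complex.norm_exp_I_mul_ofReal_sub_one,
      norm_ne_zero_iff]
    refine mul_ne_zero two_ne_zero ?_
    have h1 := hlt.trans_le (min_le_right _ _)
    rw [abs_lt] at h1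
    have hpi := Real.pi_gt_three
    rw [Ne, Real.sin_eq_zero_iff_of_lt_of_lt (by linarith) (by linarith)]
    exact div_ne_zero (sub_ne_zero.2 hne) two_ne_zero

/-- The two plane waves of the constant walk: if `z` lies on the arcs, then the dispersion relation
`a κ² - (z + det C₀ / z) κ + d = 0` has two roots of modulus `1`, distinct away from the
thresholds. -/
theorem exists_waveNumbers {p α γ : ℝ} (hp : 0 < p) {z : ℂ} (hz : ‖z‖ = 1)
    (hle : ‖z ^ 2 + Complex.exp (Complex.I * γ)‖ ≤ 2 * p) :
    ∃ κ κ' : ℂ, ‖κ‖ = 1 ∧ ‖κ'‖ = 1 ∧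
      (p : ℂ) * Complex.exp (Complex.I * α) * (κ * κ') =
        (p : ℂ) * Complex.exp (-Complex.I * (α - γ)) ∧
      (p : ℂ) * Complex.exp (Complex.I * α) * (κ + κ') * z =
        z ^ 2 + Complex.exp (Complex.I * γ) ∧
      (‖z ^ 2 + Complex.exp (Complex.I * γ)‖ ≠ 2 * p → κ ≠ κ') := by
  obtain ⟨t, rfl, ht⟩ : ∃ t : ℝ, z = Complex.exp (Complex.I * (t + γ / 2 : ℝ)) ∧
      |Real.cos t| ≤ p := by
    obtain ⟨s, -, rfl | rfl⟩ := exists_angle hz γ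
    · rw [norm_exp_sq_add_exp] at hle
      exact ⟨s, rfl, by linarith⟩
    · rw [norm_exp_sq_add_exp] at hle
      exact ⟨_, rfl, by linarith⟩
  -- The roots are `κ = e^{i(γ/2 - α ± k)}`, where `p cos k = cos t`.
  set k := Real.arccos (Real.cos t / p)
  have hk : p * Real.cos k = Real.cos t := by
    rw [abs_le] at ht
    rw [Real.cos_arccos (by rw [le_div_iff₀ hp]; linarith) (by rw [div_le_iff₀ hp]; linarith)]
    field_simp
  have h4 : (p : ℂ) * Complex.exp (Complex.I * α) *
      (Complex.exp (Complex.I * (γ / 2 - α + k : ℝ)) +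
        Complex.exp (Complex.I * (γ / 2 - α - k : ℝ))) *
      Complex.exp (Complex.I * (t + γ / 2 : ℝ)) =
      Complex.exp (Complex.I * (t + γ / 2 : ℝ)) ^ 2 + Complex.exp (Complex.I * γ) := by
    have h1 : Complex.exp (Complex.I * (γ / 2 - α + k : ℝ)) +
        Complex.exp (Complex.I * (γ / 2 - α - k : ℝ)) =
        Complex.exp (Complex.I * (γ / 2 - α : ℝ)) * (2 * Complex.cos k) := by
      rw [Complex.two_cos, mul_add, ← Complex.exp_add, ← Complex.exp_add]
      congr 2 <;> push_cast <;> ring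
    have h2 : Complex.exp (Complex.I * (t + γ / 2 : ℝ)) ^ 2 + Complex.exp (Complex.I * γ) =
        Complex.exp (Complex.I * (t + γ : ℝ)) * (2 * Complex.cos t) := by
      rw [Complex.two_cos, mul_add, ← Complex.exp_nat_mul, ← Complex.exp_add, ← Complex.exp_add]
      congr 2 <;> push_cast <;> ring
    have h3 : Complex.exp (Complex.I * (t + γ : ℝ)) = Complex.exp (Complex.I * α) *
        Complex.exp (Complex.I * (γ / 2 - α : ℝ)) * Complex.exp (Complex.I * (t + γ / 2 : ℝ)) := by
      rw [← Complex.exp_add, ← Complex.exp_add]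
      congr 1; push_cast; ring
    have hk' : (p : ℂ) * Complex.cos k = Complex.cos t := by exact_mod_cast congrArg Complex.ofReal hk
    rw [h1, h2, h3, ← hk']
    ring
  refine ⟨Complex.exp (Complex.I * (γ / 2 - α + k : ℝ)),
    Complex.exp (Complex.I * (γ / 2 - α - k : ℝ)), Complex.norm_exp_I_mul_ofReal _,
    Complex.norm_exp_I_mul_ofReal _, ?_, h4, ?_⟩
  · rw [mul_assoc, ← Complex.exp_add, ← Complex.exp_add]
    congr 2; push_cast; ring
  -- A double root has `|2 a κ z| = 2 p`.
  · intro hne heq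
    refine hne ?_
    rw [← h4, heq, ← two_mul]
    simp only [norm_mul, Complex.norm_exp_I_mul_ofReal, Complex.norm_real, Real.norm_of_nonneg hp.le]
    simp; ring

/-! ### The walk operator and its dependence on the coins -/

theorem evolutionCLM_apply_zero (C : ℤ → Matrix.unitaryGroup (Fin 2) ℂ) (ψ : State) (x : ℤ) :
    evolutionCLM C ψ x 0 = C (x + 1) 0 0 * ψ (x + 1) 0 + C (x + 1) 0 1 * ψ (x + 1) 1 := by
  have h := congrFun (evolutionCLM_apply C ψ x) 0
  simpa [Matrix.mulVec_eq_sum, Fin.sum_univ_two, mul_comm] using h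

theorem evolutionCLM_apply_one (C : ℤ → Matrix.unitaryGroup (Fin 2) ℂ) (ψ : State) (x : ℤ) :
    evolutionCLM C ψ x 1 = C (x - 1) 1 0 * ψ (x - 1) 0 + C (x - 1) 1 1 * ψ (x - 1) 1 := by
  have h := congrFun (evolutionCLM_apply C ψ x) 1
  simpa [Matrix.mulVec_eq_sum, Fin.sum_univ_two, mul_comm] using h

theorem evolutionCLM_mem_unitary (C : ℤ → Matrix.unitaryGroup (Fin 2) ℂ) :
    evolutionCLM C ∈ unitary (State →L[ℂ] State) :=
  (Unitary.linearIsometryEquiv.symm (evolution C)).2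

theorem norm_evolutionCLM (C : ℤ → Matrix.unitaryGroup (Fin 2) ℂ) (ψ : State) :
    ‖evolutionCLM C ψ‖ = ‖ψ‖ := (evolution C).norm_map ψ

theorem norm_le_mul_of_forall_le {f g : State} {c : ℝ} (hc : 0 ≤ c)
    (h : ∀ x, ‖f x‖ ≤ c * ‖g x‖) : ‖f‖ ≤ c * ‖g‖ := by
  refine le_of_sq_le_sq ?_ (by positivity)
  rw [mul_pow, norm_sq_eq_tsum, norm_sq_eq_tsum, ← tsum_mul_left]
  refine (summable_sq f).tsum_le_tsum (fun x => ?_) ((summable_sq g).mul_left _)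
  rw [← mul_pow]
  exact pow_le_pow_left₀ (norm_nonneg _) (h x) 2

theorem norm_apply_le_maxNorm (A : Matrix (Fin 2) (Fin 2) ℂ) (i j : Fin 2) :
    ‖A i j‖ ≤ maxNorm A := by
  unfold maxNorm
  fin_cases i <;> fin_cases j <;> simp

theorem maxNorm_nonneg (A : Matrix (Fin 2) (Fin 2) ℂ) : 0 ≤ maxNorm A :=
  (norm_nonneg _).trans (norm_apply_le_maxNorm A 0 0)

theorem norm_coinAct_sub_le (A B : Matrix.unitaryGroup (Fin 2) ℂ) (v : Site) :
    ‖coinAct A v - coinAct B v‖ ≤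
      2 * maxNorm ((A : Matrix (Fin 2) (Fin 2) ℂ) - B) * ‖v‖ := by
  set m := maxNorm ((A : Matrix (Fin 2) (Fin 2) ℂ) - B)
  have hm : 0 ≤ m := maxNorm_nonneg _
  have hcomp : ∀ i, ‖(coinAct A v - coinAct B v) i‖ ≤ m * (‖v 0‖ + ‖v 1‖) := by
    intro i
    have h1 : (coinAct A v - coinAct B v) i =
        ((A : Matrix (Fin 2) (Fin 2) ℂ) - B) i 0 * v 0 +
          ((A : Matrix (Fin 2) (Fin 2) ℂ) - B) i 1 * v 1 := by
      simp [coinAct, Matrix.mulVec_eq_sum, Fin.sum_univ_two]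
      ring
    rw [h1, mul_add]
    refine (norm_add_le _ _).trans (add_le_add ?_ ?_) <;> rw [norm_mul] <;>
      exact mul_le_mul_of_nonneg_right (norm_apply_le_maxNorm _ _ _) (norm_nonneg _)
  refine le_of_sq_le_sq ?_ (by positivity)
  rw [site_norm_sq, mul_pow, site_norm_sq v]
  have h0 := pow_le_pow_left₀ (norm_nonneg _) (hcomp 0) 2
  have h1 := pow_le_pow_left₀ (norm_nonneg _) (hcomp 1) 2
  have h2 : (‖v 0‖ + ‖v 1‖) ^ 2 ≤ 2 * (‖v 0‖ ^ 2 + ‖v 1‖ ^ 2) := by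
    nlinarith [sq_nonneg (‖v 0‖ - ‖v 1‖)]
  rw [mul_pow] at h0 h1
  nlinarith [mul_le_mul_of_nonneg_left h2 (sq_nonneg m)]

/-- Only the coins on the support of `ψ` matter for `U ψ`. -/
theorem norm_evolutionCLM_sub_le {C C' : ℤ → Matrix.unitaryGroup (Fin 2) ℂ} {ψ : State} {ε : ℝ}
    (hε : 0 ≤ ε) (h : ∀ x, ψ x ≠ 0 →
      maxNorm ((C x : Matrix (Fin 2) (Fin 2) ℂ) - C' x) ≤ ε) :
    ‖evolutionCLM C ψ - evolutionCLM C' ψ‖ ≤ 2 * ε * ‖ψ‖ := by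
  have h1 : evolutionCLM C ψ - evolutionCLM C' ψ = shiftOp (coinOp C ψ - coinOp C' ψ) :=
    (map_sub shiftOp (coinOp C ψ) (coinOp C' ψ)).symm
  rw [h1, shiftOp.norm_map]
  refine norm_le_mul_of_forall_le (by positivity) fun x => ?_
  change ‖coinAct (C x) (ψ x) - coinAct (C' x) (ψ x)‖ ≤ _
  by_cases hx : ψ x = 0
  · rw [hx, ← zero_smul ℂ (0 : Site), coinAct_smul, coinAct_smul]
    simp
  · refine (norm_coinAct_sub_le _ _ _).trans ?_
    gcongr
    exact h x hx

/-- The restriction of a state to finitely many sites. -/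
def restrictTo (s : Finset ℤ) : State →L[ℂ] State :=
  ∑ x ∈ s, (lp.singleContinuousLinearMap ℂ (fun _ : ℤ => Site) 2 x).comp
    (lp.evalCLM ℂ (fun _ : ℤ => Site) 2 x)

theorem restrictTo_apply (s : Finset ℤ) (ψ : State) (x : ℤ) :
    restrictTo s ψ x = if x ∈ s then ψ x else 0 := by
  simp only [restrictTo, sum_apply, ContinuousLinearMap.comp_apply,
    lp.singleContinuousLinearMap_apply, lp.coeFn_sum, Finset.sum_apply, lp.coeFn_single]
  simp [Pi.single_apply, lp.evalCLM]

theorem isCompactOperator_restrictTo (s : Finset ℤ) : IsCompactOperator (restrictTo s) := by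
  refine Submodule.sum_mem (compactOperator (RingHom.id ℂ) State State) fun x _ => ?_
  have h : IsCompactOperator (lp.evalCLM ℂ (fun _ : ℤ => Site) 2 x) :=
    isCompactOperator_of_locallyCompactSpace_dom _
  exact h.clm_comp (lp.singleContinuousLinearMap ℂ (fun _ : ℤ => Site) 2 x)

/-- Walks whose coins agree asymptotically differ by a compact operator: the difference is the
norm limit of its restrictions to finitely many sites. -/
theorem isCompactOperator_evolutionCLM_sub {C C' : ℤ → Matrix.unitaryGroup (Fin 2) ℂ}
    (h : Tendsto (fun x => maxNorm ((C x : Matrix (Fin 2) (Fin 2) ℂ) - C' x)) cofinite (𝓝 0)) :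
    IsCompactOperator (evolutionCLM C - evolutionCLM C') := by
  set K := evolutionCLM C - evolutionCLM C'
  refine isCompactOperator_of_tendsto (F := fun s : Finset ℤ => K.comp (restrictTo s))
    (l := atTop) (f := K) ?_
    (Eventually.of_forall fun s => (isCompactOperator_restrictTo s).clm_comp K)
  rw [Metric.tendsto_atTop]
  intro ε hε
  have hfin : {x | ¬ maxNorm ((C x : Matrix (Fin 2) (Fin 2) ℂ) - C' x) < ε / 4}.Finite :=
    h.eventually (gt_mem_nhds (by positivity : (0 : ℝ) < ε / 4))
  refine ⟨hfin.toFinset, fun s hs => ?_⟩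
  rw [dist_eq_norm, norm_sub_rev]
  refine (ContinuousLinearMap.opNorm_le_bound _ (by positivity : 0 ≤ ε / 2) fun ψ => ?_).trans_lt
    (half_lt_self hε)
  have hval : ∀ x, (ψ - restrictTo s ψ) x = if x ∈ s then 0 else ψ x := fun x => by
    rw [lp.coeFn_sub, Pi.sub_apply, restrictTo_apply]
    split_ifs <;> simp
  have h1 : (K - K.comp (restrictTo s)) ψ =
      evolutionCLM C (ψ - restrictTo s ψ) - evolutionCLM C' (ψ - restrictTo s ψ) := by
    simp only [K, sub_apply, ContinuousLinearMap.comp_apply, map_sub]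
    abel
  have h2 : ‖ψ - restrictTo s ψ‖ ≤ 1 * ‖ψ‖ := by
    refine norm_le_mul_of_forall_le zero_le_one fun x => ?_
    rw [hval]
    split_ifs <;> simp
  rw [h1]
  refine (norm_evolutionCLM_sub_le (ε := ε / 4) (by positivity) fun x hx => ?_).trans ?_
  · by_contra hcon
    refine hx ?_
    rw [hval, if_pos]
    exact hs (hfin.mem_toFinset.2 fun h => hcon h.le)
  · linarith [mul_le_mul_of_nonneg_left h2 hε.le]

/-! ### The constant walk off the arcs -/

/-- The translate `x ↦ ψ (x + s)` of a state. -/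
def translate (s : ℤ) (ψ : State) : State :=
  ⟨fun x => ψ (x + s), (memlp_iff_summable_sq _).2
    ((Equiv.addRight s).summable_iff (f := fun x => ‖ψ x‖ ^ 2) |>.2 (summable_sq ψ))⟩

theorem translate_apply (s : ℤ) (ψ : State) (x : ℤ) : translate s ψ x = ψ (x + s) := rfl

theorem norm_translate (s : ℤ) (ψ : State) : ‖translate s ψ‖ = ‖ψ‖ := by
  rw [← sq_eq_sq₀ (norm_nonneg _) (norm_nonneg _), norm_sq_eq_tsum, norm_sq_eq_tsum]
  exact (Equiv.addRight s).tsum_eq fun x => ‖ψ x‖ ^ 2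

/-- The Cayley–Hamilton identity of the constant walk `U`: with `τ` the translation,
`U² + det A = (a τ + d τ⁻¹) U`. -/
theorem evolutionCLM_const_cayleyHamilton (A : Matrix.unitaryGroup (Fin 2) ℂ) (ψ : State) :
    evolutionCLM (fun _ => A) (evolutionCLM (fun _ => A) ψ) +
        (A : Matrix (Fin 2) (Fin 2) ℂ).det • ψ =
      A 0 0 • translate 1 (evolutionCLM (fun _ => A) ψ) +
        A 1 1 • translate (-1) (evolutionCLM (fun _ => A) ψ) := by
  ext x i
  simp only [lp.coeFn_add, lp.coeFn_smul, Pi.add_apply, Pi.smul_apply, PiLp.add_apply,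
    PiLp.smul_apply, translate_apply, smul_eq_mul, Matrix.det_fin_two]
  fin_cases i
  · simp only [Fin.zero_eta, evolutionCLM_apply_zero, evolutionCLM_apply_one, ← sub_eq_add_neg,
      sub_add_cancel, add_sub_cancel_right]
    ring
  · simp only [Fin.mk_one, evolutionCLM_apply_zero, evolutionCLM_apply_one, ← sub_eq_add_neg,
      sub_add_cancel, add_sub_cancel_right]
    ring

/-- A lower bound for `U - z` for the constant walk, nontrivial when `|z² + det A| > |a| + |d|`. -/
theorem norm_sq_add_det_mul_norm_le (A : Matrix.unitaryGroup (Fin 2) ℂ) {z : ℂ} (hz : ‖z‖ = 1)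
    (ψ : State) :
    ‖z ^ 2 + (A : Matrix (Fin 2) (Fin 2) ℂ).det‖ * ‖ψ‖ ≤
      (‖A 0 0‖ + ‖A 1 1‖) * ‖ψ‖ + 2 * ‖evolutionCLM (fun _ => A) ψ - z • ψ‖ := by
  set U := evolutionCLM (fun _ => A)
  set D := (A : Matrix (Fin 2) (Fin 2) ℂ).det
  set r := U ψ - z • ψ with hr
  have h1 : (z ^ 2 + D) • ψ = (U (U ψ) + D • ψ) - (z • r + U r) := by
    simp only [hr, map_sub, map_smul, smul_sub, add_smul, pow_two, mul_smul]
    abel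
  have h2 : ‖U (U ψ) + D • ψ‖ ≤ (‖A 0 0‖ + ‖A 1 1‖) * ‖ψ‖ := by
    rw [evolutionCLM_const_cayleyHamilton]
    refine (norm_add_le _ _).trans_eq ?_
    rw [norm_smul, norm_smul, norm_translate, norm_translate, norm_evolutionCLM, add_mul]
  have h3 : ‖z • r + U r‖ ≤ 2 * ‖r‖ := by
    refine (norm_add_le _ _).trans_eq ?_
    rw [norm_smul, hz, norm_evolutionCLM]
    ring
  rw [← norm_smul, h1]
  exact (norm_sub_le _ _).trans (add_le_add h2 h3)

/-! ### Wave packets -/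

/-- The plane wave `κ ^ x u` cut off to the `L` sites from `N` on. -/
def wavePacket (κ : ℂ) (u : Site) (N : ℤ) (L : ℕ) : State :=
  ∑ x ∈ Finset.Ico N (N + L), lp.single 2 x (κ ^ x • u)

theorem wavePacket_apply (κ : ℂ) (u : Site) (N : ℤ) (L : ℕ) (x : ℤ) :
    wavePacket κ u N L x = if x ∈ Finset.Ico N (N + L) then κ ^ x • u else 0 := by
  simp only [wavePacket, lp.coeFn_sum, Finset.sum_apply, lp.coeFn_single]
  simp [Pi.single_apply]

theorem norm_wavePacket_sq {κ : ℂ} (hκ : ‖κ‖ = 1) (u : Site) (N : ℤ) (L : ℕ) :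
    ‖wavePacket κ u N L‖ ^ 2 = L * ‖u‖ ^ 2 := by
  have h := lp.norm_sum_single (E := fun _ : ℤ => Site) (p := 2) (by norm_num)
    (fun x => κ ^ x • u) (Finset.Ico N (N + L))
  simpa [norm_smul, hκ, wavePacket] using h

/-- If `κ ^ x u` solves the eigenvalue equation of the constant walk, then a wave packet solves it
except at its four boundary sites. -/
theorem norm_evolutionCLM_wavePacket_sub_le {A : Matrix.unitaryGroup (Fin 2) ℂ} {z κ : ℂ}
    (hz : ‖z‖ = 1) (hκ : ‖κ‖ = 1) {u : Site}
    (h0 : A 0 0 * κ * u 0 + A 0 1 * κ * u 1 = z * u 0)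
    (h1 : A 1 0 * u 0 + A 1 1 * u 1 = z * κ * u 1) (N : ℤ) (L : ℕ) :
    ‖evolutionCLM (fun _ => A) (wavePacket κ u N L) - z • wavePacket κ u N L‖ ≤ 2 * ‖u‖ := by
  have hκ0 : κ ≠ 0 := norm_ne_zero_iff.1 (by rw [hκ]; exact one_ne_zero)
  set r := evolutionCLM (fun _ => A) (wavePacket κ u N L) - z • wavePacket κ u N L with hr
  set I : ℤ → ℂ := fun x => if x ∈ Finset.Ico N (N + L) then 1 else 0 with hI
  have hψ : ∀ x i, wavePacket κ u N L x i = I x * (κ ^ x * u i) := fun x i => by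
    rw [wavePacket_apply, hI]
    split_ifs <;> simp [*]
  have hr0 : ∀ x, r x 0 = (I (x + 1) - I x) * (κ ^ x * z * u 0) := by
    intro x
    rw [hr, lp.coeFn_sub, lp.coeFn_smul, Pi.sub_apply, Pi.smul_apply, PiLp.sub_apply,
      PiLp.smul_apply, evolutionCLM_apply_zero, smul_eq_mul]
    simp only [hψ]
    rw [zpow_add_one₀ hκ0]
    linear_combination I (x + 1) * κ ^ x * h0
  have hr1 : ∀ x, r x 1 = (I (x - 1) - I x) * (κ ^ x * z * u 1) := by
    intro x
    rw [hr, lp.coeFn_sub, lp.coeFn_smul, Pi.sub_apply, Pi.smul_apply, PiLp.sub_apply,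
      PiLp.smul_apply, evolutionCLM_apply_one, smul_eq_mul]
    simp only [hψ]
    have hx : κ ^ x = κ ^ (x - 1) * κ := by rw [← zpow_add_one₀ hκ0, sub_add_cancel]
    rw [hx]
    linear_combination I (x - 1) * κ ^ (x - 1) * h1
  have hI01 : ∀ x y, ‖I x - I y‖ ≤ 1 := fun x y => by
    simp only [hI]
    split_ifs <;> simp
  have hle : ∀ x, ‖r x‖ ^ 2 ≤ ‖u‖ ^ 2 := by
    intro x
    rw [site_norm_sq, site_norm_sq u, hr0, hr1]
    simp only [norm_mul, norm_zpow, hκ, hz, one_zpow, one_mul]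
    gcongr
    · exact mul_le_of_le_one_left (norm_nonneg _) (hI01 _ _)
    · exact mul_le_of_le_one_left (norm_nonneg _) (hI01 _ _)
  set s : Finset ℤ := {N - 1, N + L - 1, N, N + L}
  have hsupp : ∀ x ∉ s, ‖r x‖ ^ 2 = 0 := by
    intro x hx
    simp only [s, Finset.mem_insert, Finset.mem_singleton, not_or] at hx
    have e0 : I (x + 1) = I x := by
      simp only [hI, Finset.mem_Ico]
      congr 1
      rw [eq_iff_iff]
      omega
    have e1 : I (x - 1) = I x := by
      simp only [hI, Finset.mem_Ico]
      congr 1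
      rw [eq_iff_iff]
      omega
    rw [site_norm_sq, hr0, hr1, e0, e1]
    simp
  refine le_of_sq_le_sq ?_ (by positivity)
  rw [norm_sq_eq_tsum, tsum_eq_sum hsupp]
  refine (Finset.sum_le_card_nsmul s _ _ fun x _ => hle x).trans ?_
  have hcard : (s.card : ℝ) ≤ 4 := by exact_mod_cast Finset.card_le_four
  rw [nsmul_eq_mul, mul_pow]
  nlinarith [sq_nonneg ‖u‖]

/-- Weyl's criterion with wave packets far to the right: a wave number `κ` of modulus `1` solving
the dispersion relation of the limit coin puts `z` in the spectrum. -/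
theorem mem_spectrum_of_dispersion {C : ℤ → Matrix.unitaryGroup (Fin 2) ℂ}
    {A : Matrix.unitaryGroup (Fin 2) ℂ}
    (h : Tendsto (fun x => maxNorm ((C x : Matrix (Fin 2) (Fin 2) ℂ) - A)) atTop (𝓝 0))
    {z κ : ℂ} (hz : ‖z‖ = 1) (hκ : ‖κ‖ = 1)
    (hdisp : (A 0 0 * κ - z) * (A 1 1 - z * κ) - A 0 1 * κ * A 1 0 = 0) :
    z ∈ spectrum ℂ (evolutionCLM C) := by
  obtain ⟨w, hw, hBw⟩ := Matrix.exists_mulVec_eq_zero_iff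
    (M := !![A 0 0 * κ - z, A 0 1 * κ; A 1 0, A 1 1 - z * κ]) |>.2 (by
      rw [Matrix.det_fin_two_of]; exact hdisp)
  set u : Site := WithLp.toLp 2 w
  have hu : 0 < ‖u‖ := norm_pos_iff.2 fun h0 => hw ((WithLp.toLp_eq_zero 2).1 h0)
  have e0 := congrFun hBw 0
  have e1 := congrFun hBw 1
  simp only [Matrix.mulVec_eq_sum, Fin.sum_univ_two, Matrix.of_apply, Matrix.cons_val',
    Matrix.cons_val_zero, Matrix.cons_val_one, Pi.add_apply, Pi.smul_apply, Pi.zero_apply,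
    Matrix.transpose_apply, MulOpposite.smul_eq_mul_unop, MulOpposite.unop_op,
    Matrix.cons_val_fin_one] at e0 e1
  refine mem_spectrum_of_approx fun ε hε => ?_
  obtain ⟨n, hn⟩ := exists_nat_gt (4 / ε)
  have hn' : 4 < ε * n := by rwa [div_lt_iff₀' hε] at hn
  obtain ⟨N, hN⟩ := eventually_atTop.1
    (h.eventually (gt_mem_nhds (by positivity : (0 : ℝ) < ε / 8)))
  -- Length `n ^ 2` gives `‖ψ‖ = n ‖u‖`, against a boundary error of `2 ‖u‖`.
  set ψ := wavePacket κ u N (n ^ 2) with hψ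
  have hnorm : ‖ψ‖ = n * ‖u‖ := by
    rw [← sq_eq_sq₀ (norm_nonneg _) (by positivity), hψ, norm_wavePacket_sq hκ, mul_pow]
    push_cast
    ring
  have b1 := norm_evolutionCLM_wavePacket_sub_le (A := A) hz hκ (u := u)
    (by change A 0 0 * κ * w 0 + A 0 1 * κ * w 1 = z * w 0; linear_combination e0)
    (by change A 1 0 * w 0 + A 1 1 * w 1 = z * κ * w 1; linear_combination e1) N (n ^ 2)
  have b2 := norm_evolutionCLM_sub_le (C := C) (C' := fun _ => A) (ψ := ψ)
    (by positivity : 0 ≤ ε / 8) fun x hx => by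
      refine (hN x ?_).le
      by_contra hcon
      refine hx ?_
      rw [hψ, wavePacket_apply, if_neg]
      simp only [Finset.mem_Ico]
      omega
  refine ⟨ψ, ?_⟩
  have h3 : evolutionCLM C ψ - z • ψ = (evolutionCLM C ψ - evolutionCLM (fun _ => A) ψ) +
      (evolutionCLM (fun _ => A) ψ - z • ψ) := by abel
  rw [h3]
  refine (norm_add_le _ _).trans_lt ?_
  rw [hnorm] at b2 ⊢
  nlinarith [mul_lt_mul_of_pos_right hn' hu]

/-! ### Absence of decaying solutions -/

/-- A summable relative loss does not drive a nonzero sequence to `0`. -/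
theorem exists_eq_zero_of_summable_loss {u e : ℕ → ℝ} (hu : ∀ n, 0 ≤ u n) (he0 : ∀ n, 0 ≤ e n)
    (he : Summable e) (hstep : ∀ n, (1 - e n) * u n ≤ u (n + 1))
    (hlim : Tendsto u atTop (𝓝 0)) : ∃ n, u n = 0 := by
  -- From `n₀` on the losses sum to less than `1 / 2`, so `u` never drops below `u n₀ / 2`.
  obtain ⟨n₀, hn₀⟩ := ((tendsto_sum_nat_add e).eventually
    (gt_mem_nhds (by norm_num : (0 : ℝ) < 1 / 2))).exists
  have hsum : Summable fun k => e (k + n₀) := (summable_nat_add_iff n₀).2 he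
  have hle : ∀ s : Finset ℕ, ∑ k ∈ s, e (k + n₀) ≤ 1 / 2 := fun s =>
    (hsum.sum_le_tsum s fun _ _ => he0 _).trans hn₀.le
  have hbound : ∀ m, (1 - ∑ k ∈ Finset.range m, e (k + n₀)) * u n₀ ≤ u (m + n₀) := by
    intro m
    induction m with
    | zero => simp
    | succ m ih =>
      have h1 := hstep (m + n₀)
      have h2 : e (m + n₀) ≤ 1 / 2 := by simpa using hle {m}
      have h3 : 0 ≤ ∑ k ∈ Finset.range m, e (k + n₀) := Finset.sum_nonneg fun _ _ => he0 _
      rw [Finset.sum_range_succ, add_right_comm m 1 n₀]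
      refine le_trans ?_ (le_trans (mul_le_mul_of_nonneg_left ih (by linarith)) h1)
      nlinarith [mul_nonneg (mul_nonneg (he0 (m + n₀)) h3) (hu n₀)]
  refine ⟨n₀, le_antisymm ?_ (hu n₀)⟩
  have h1 : ∀ m, 1 / 2 * u n₀ ≤ u (m + n₀) := fun m =>
    (mul_le_mul_of_nonneg_right (by linarith [hle (Finset.range m)]) (hu n₀)).trans (hbound m)
  have h2 := ge_of_tendsto' ((tendsto_add_atTop_iff_nat n₀).2 hlim) h1
  linarith

/-- Let `T₀` satisfy a quadratic equation whose roots `κ ≠ κ'` have modulus `1`. Then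
`‖T₀ w - κ w‖ + ‖T₀ w - κ' w‖` is an equivalent norm for which `T₀` is isometric, so a summable
perturbation of the recursion `φ (n + 1) = T₀ (φ n)` has no decaying solution without zeros. -/
theorem exists_eq_zero_of_summable_perturbation {E : Type*} [NormedAddCommGroup E]
    [NormedSpace ℂ E] {T₀ : E →L[ℂ] E} {κ κ' : ℂ} (hκ : ‖κ‖ = 1) (hκ' : ‖κ'‖ = 1)
    (hne : κ ≠ κ') (hquad : ∀ w, T₀ (T₀ w) - (κ + κ') • T₀ w + (κ * κ') • w = 0)
    {φ : ℕ → E} {e : ℕ → ℝ} (he0 : ∀ n, 0 ≤ e n) (he : Summable e)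
    (hstep : ∀ n, ‖φ (n + 1) - T₀ (φ n)‖ ≤ e n * ‖φ n‖) (hlim : Tendsto φ atTop (𝓝 0)) :
    ∃ n, φ n = 0 := by
  set N : E → ℝ := fun w => ‖T₀ w - κ • w‖ + ‖T₀ w - κ' • w‖ with hN
  have hN0 : ∀ w, 0 ≤ N w := fun w => by positivity
  have hiso : ∀ w, N (T₀ w) = N w := by
    intro w
    have h1 : T₀ (T₀ w) - κ • T₀ w = κ' • (T₀ w - κ • w) := by
      rw [← sub_eq_zero, ← hquad w, smul_sub, add_smul, smul_smul, mul_comm κ κ']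
      abel
    have h2 : T₀ (T₀ w) - κ' • T₀ w = κ • (T₀ w - κ' • w) := by
      rw [← sub_eq_zero, ← hquad w, smul_sub, add_smul, smul_smul]
      abel
    simp only [hN]
    rw [h1, h2, norm_smul, norm_smul, hκ, hκ', one_mul, one_mul]
  have hlower : ∀ w, ‖κ - κ'‖ * ‖w‖ ≤ N w := by
    intro w
    have h1 : (κ - κ') • w = (T₀ w - κ' • w) - (T₀ w - κ • w) := by rw [sub_smul]; abel
    rw [← norm_smul, h1]
    exact (norm_sub_le _ _).trans_eq (add_comm _ _)
  have hupper : ∀ w, N w ≤ 2 * (‖T₀‖ + 1) * ‖w‖ := by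
    intro w
    have h1 : ∀ c : ℂ, ‖c‖ = 1 → ‖T₀ w - c • w‖ ≤ (‖T₀‖ + 1) * ‖w‖ := fun c hc => by
      refine (norm_sub_le _ _).trans ?_
      rw [norm_smul, hc, add_mul]
      gcongr
      exact T₀.le_opNorm w
    linarith [h1 κ hκ, h1 κ' hκ']
  have hadd : ∀ w w', N w ≤ N w' + N (w' - w) := by
    intro w w'
    have h1 : ∀ c : ℂ, ‖T₀ w - c • w‖ ≤ ‖T₀ w' - c • w'‖ + ‖T₀ (w' - w) - c • (w' - w)‖ :=
      fun c => by
        have h2 : T₀ w - c • w = (T₀ w' - c • w') - (T₀ (w' - w) - c • (w' - w)) := by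
          rw [map_sub, smul_sub]; abel
        rw [h2]
        exact norm_sub_le _ _
    simp only [hN]
    linarith [h1 κ, h1 κ']
  have hgap : 0 < ‖κ - κ'‖ := norm_pos_iff.2 (sub_ne_zero.2 hne)
  set B := 2 * (‖T₀‖ + 1) / ‖κ - κ'‖ with hB
  have hB0 : 0 ≤ B := by positivity
  have hNlim : Tendsto (fun n => N (φ n)) atTop (𝓝 0) := by
    refine squeeze_zero (fun n => hN0 _) (fun n => hupper (φ n)) ?_
    simpa using hlim.norm.const_mul (2 * (‖T₀‖ + 1))
  have hloss : ∀ n, (1 - B * e n) * N (φ n) ≤ N (φ (n + 1)) := by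
    intro n
    have h1 := hadd (T₀ (φ n)) (φ (n + 1))
    rw [hiso] at h1
    have h2 := hupper (φ (n + 1) - T₀ (φ n))
    have h3 : 2 * (‖T₀‖ + 1) * ‖φ (n + 1) - T₀ (φ n)‖ ≤ B * e n * N (φ n) := by
      calc _ ≤ 2 * (‖T₀‖ + 1) * (e n * ‖φ n‖) := by gcongr; exact hstep n
        _ = B * e n * (‖κ - κ'‖ * ‖φ n‖) := by rw [hB]; field_simp
        _ ≤ _ := mul_le_mul_of_nonneg_left (hlower _) (mul_nonneg hB0 (he0 n))
    linarith
  obtain ⟨n, hn⟩ := exists_eq_zero_of_summable_loss (fun n => hN0 (φ n))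
    (fun n => mul_nonneg hB0 (he0 n)) (he.mul_left B) hloss hNlim
  have h1 := hlower (φ n)
  rw [hn] at h1
  exact ⟨n, norm_le_zero_iff.1 (nonpos_of_mul_nonpos_right h1 hgap)⟩

/-- The transfer matrix of the constant walk, taking `(ψ⁽⁰⁾(x - 1), ψ⁽¹⁾(x))` to
`(ψ⁽⁰⁾(x), ψ⁽¹⁾(x + 1))` for a solution `ψ` of `U ψ = z ψ`. -/
def transferCLM (A : Matrix (Fin 2) (Fin 2) ℂ) (z : ℂ) : ℂ × ℂ →L[ℂ] ℂ × ℂ :=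
  LinearMap.toContinuousLinearMap
    { toFun := fun w => ((A 0 0)⁻¹ * (z * w.1 - A 0 1 * w.2),
        z⁻¹ * (A 1 0 * ((A 0 0)⁻¹ * (z * w.1 - A 0 1 * w.2)) + A 1 1 * w.2))
      map_add' := fun v w => by ext <;> simp <;> ring
      map_smul' := fun c w => by ext <;> simp <;> ring }

theorem transferCLM_apply (A : Matrix (Fin 2) (Fin 2) ℂ) (z : ℂ) (w : ℂ × ℂ) :
    transferCLM A z w = ((A 0 0)⁻¹ * (z * w.1 - A 0 1 * w.2),
      z⁻¹ * (A 1 0 * ((A 0 0)⁻¹ * (z * w.1 - A 0 1 * w.2)) + A 1 1 * w.2)) := rfl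

theorem transferCLM_quadratic {A : Matrix (Fin 2) (Fin 2) ℂ} {z κ κ' : ℂ} (ha : A 0 0 ≠ 0)
    (hz : z ≠ 0) (hprod : A 0 0 * (κ * κ') = A 1 1)
    (hsum : A 0 0 * (κ + κ') * z = z ^ 2 + A.det) (w : ℂ × ℂ) :
    transferCLM A z (transferCLM A z w) - (κ + κ') • transferCLM A z w + (κ * κ') • w = 0 := by
  have h1 : κ * κ' = A 1 1 / A 0 0 := by rw [← hprod]; field_simp
  have h2 : κ + κ' = (z ^ 2 + (A 0 0 * A 1 1 - A 0 1 * A 1 0)) / (A 0 0 * z) := by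
    rw [← Matrix.det_fin_two, ← hsum]; field_simp
  rw [h1, h2]
  obtain ⟨f, g⟩ := w
  simp only [transferCLM_apply]
  ext
  · simp only [Prod.fst_add, Prod.fst_sub, Prod.smul_fst, smul_eq_mul, Prod.fst_zero]
    field_simp
    ring
  · simp only [Prod.snd_add, Prod.snd_sub, Prod.smul_snd, smul_eq_mul, Prod.snd_zero]
    field_simp
    ring

theorem norm_unitary_apply_le_one (A : Matrix.unitaryGroup (Fin 2) ℂ) (i j : Fin 2) :
    ‖A i j‖ ≤ 1 := entry_norm_bound_of_unitary A.2 i j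

theorem norm_zero_zero_eq_norm_one_one (A : Matrix.unitaryGroup (Fin 2) ℂ) :
    ‖A 0 0‖ = ‖A 1 1‖ := by
  have h1 := congrFun (congrFun (Matrix.UnitaryGroup.star_mul_self A) 0) 0
  have h2 := congrFun (congrFun (Matrix.mem_unitaryGroup_iff.1 A.2) 1) 1
  simp only [Matrix.mul_apply, Fin.sum_univ_two, Matrix.star_apply, Matrix.one_apply_eq,
    Complex.star_def, Complex.conj_mul', Complex.mul_conj'] at h1 h2
  have h1' : ‖A 0 0‖ ^ 2 + ‖A 1 0‖ ^ 2 = 1 := by exact_mod_cast h1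
  have h2' : ‖A 1 0‖ ^ 2 + ‖A 1 1‖ ^ 2 = 1 := by exact_mod_cast h2
  rw [← sq_eq_sq₀ (norm_nonneg _) (norm_nonneg _)]
  linarith

/-- One step of the eigenvalue equation with coin `B` differs from the transfer matrix of the
coin `A` by an error proportional to `B - A`. -/
theorem norm_sub_transferCLM_le {A B : Matrix.unitaryGroup (Fin 2) ℂ} {z : ℂ} (hz : ‖z‖ = 1)
    (ha : A 0 0 ≠ 0) {δ : ℝ} (hδ : 0 < δ) (hB : δ ≤ ‖B 0 0‖) {w w' : ℂ × ℂ}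
    (h1 : z * w.1 = B 0 0 * w'.1 + B 0 1 * w.2) (h2 : z * w'.2 = B 1 0 * w'.1 + B 1 1 * w.2) :
    ‖w' - transferCLM A z w‖ ≤ (2 / δ + 1) * (‖A 0 0‖⁻¹ + 1) *
      maxNorm ((B : Matrix (Fin 2) (Fin 2) ℂ) - A) * ‖w‖ := by
  set m := maxNorm ((B : Matrix (Fin 2) (Fin 2) ℂ) - A)
  have hm : 0 ≤ m := maxNorm_nonneg _
  have hm' : ∀ i j, ‖B i j - A i j‖ ≤ m := fun i j => norm_apply_le_maxNorm (_ - _) i j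
  have hz0 : z ≠ 0 := norm_ne_zero_iff.1 (by rw [hz]; exact one_ne_zero)
  have hw1 : ‖w.1‖ ≤ ‖w‖ := norm_fst_le w
  have hw2 : ‖w.2‖ ≤ ‖w‖ := norm_snd_le w
  have hf' : ‖w'.1‖ ≤ 2 / δ * ‖w‖ := by
    have e1 : B 0 0 * w'.1 = z * w.1 - B 0 1 * w.2 := by linear_combination -h1
    have e2 : ‖B 0 0 * w'.1‖ ≤ 2 * ‖w‖ := by
      rw [e1]
      refine (norm_sub_le _ _).trans ?_
      rw [norm_mul, norm_mul, hz, one_mul]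
      have := mul_le_of_le_one_left (norm_nonneg w.2) (norm_unitary_apply_le_one B 0 1)
      linarith
    rw [norm_mul] at e2
    rw [div_mul_eq_mul_div, le_div_iff₀' hδ]
    exact (mul_le_mul_of_nonneg_right hB (norm_nonneg _)).trans e2
  have hcomb : ∀ i, ‖(B i 0 - A i 0) * w'.1 + (B i 1 - A i 1) * w.2‖ ≤
      m * ((2 / δ + 1) * ‖w‖) := by
    intro i
    refine (norm_add_le _ _).trans ?_
    rw [norm_mul, norm_mul, add_mul, mul_add, one_mul]
    gcongr
    · exact hm' i 0
    · exact hm' i 1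
  have hpos : 0 ≤ m * ((2 / δ + 1) * ‖w‖) := by positivity
  set g := w' - transferCLM A z w with hg
  have e1 : g.1 = -((A 0 0)⁻¹ * ((B 0 0 - A 0 0) * w'.1 + (B 0 1 - A 0 1) * w.2)) := by
    simp only [hg, transferCLM_apply, Prod.fst_sub]
    field_simp
    linear_combination -h1
  have e2 : g.2 = z⁻¹ * (A 1 0 * g.1 + ((B 1 0 - A 1 0) * w'.1 + (B 1 1 - A 1 1) * w.2)) := by
    simp only [hg, transferCLM_apply, Prod.fst_sub, Prod.snd_sub]
    have e3 : w'.2 = z⁻¹ * (z * w'.2) := by field_simp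
    rw [e3, h2]
    ring
  have n1 : ‖g.1‖ ≤ ‖A 0 0‖⁻¹ * (m * ((2 / δ + 1) * ‖w‖)) := by
    rw [e1, norm_neg, norm_mul, norm_inv]
    exact mul_le_mul_of_nonneg_left (hcomb 0) (by positivity)
  have n2 : ‖g.2‖ ≤ ‖A 0 0‖⁻¹ * (m * ((2 / δ + 1) * ‖w‖)) + m * ((2 / δ + 1) * ‖w‖) := by
    rw [e2, norm_mul, norm_inv, hz, inv_one, one_mul]
    refine (norm_add_le _ _).trans (add_le_add ?_ (hcomb 1))
    rw [norm_mul]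
    exact (mul_le_of_le_one_left (norm_nonneg _) (norm_unitary_apply_le_one A 1 0)).trans n1
  rw [Prod.norm_def]
  refine (max_le (n1.trans (le_add_of_nonneg_right hpos)) n2).trans_eq ?_
  ring

/-- A walk without edge defects whose coins converge summably to the coin `A` on the right has no
eigenvalue `z` for which the dispersion relation of `A` has two distinct roots of modulus `1`. -/
theorem not_isEigenvalue_of_dispersion {C : ℤ → Matrix.unitaryGroup (Fin 2) ℂ}
    {A : Matrix.unitaryGroup (Fin 2) ℂ} (ha : A 0 0 ≠ 0) {δ : ℝ} (hδ : 0 < δ)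
    (hC : ∀ x, δ ≤ ‖C x 0 0‖)
    (hsummable : Summable fun n : ℕ => maxNorm ((C n : Matrix (Fin 2) (Fin 2) ℂ) - A))
    {z κ κ' : ℂ} (hz : ‖z‖ = 1) (hκ : ‖κ‖ = 1) (hκ' : ‖κ'‖ = 1) (hne : κ ≠ κ')
    (hprod : A 0 0 * (κ * κ') = A 1 1)
    (hsum : A 0 0 * (κ + κ') * z = z ^ 2 + (A : Matrix (Fin 2) (Fin 2) ℂ).det) :
    ¬ IsEigenvalue (evolutionCLM C) z := by
  rw [isEigenvalue_iff]
  rintro ⟨ψ, hψ, heig⟩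
  have hz0 : z ≠ 0 := norm_ne_zero_iff.1 (by rw [hz]; exact one_ne_zero)
  have eq0 : ∀ x, z * ψ (x - 1) 0 = C x 0 0 * ψ x 0 + C x 0 1 * ψ x 1 := fun x => by
    have h1 := evolutionCLM_apply_zero C ψ (x - 1)
    rw [heig] at h1
    simpa using h1
  have eq1 : ∀ x, z * ψ (x + 1) 1 = C x 1 0 * ψ x 0 + C x 1 1 * ψ x 1 := fun x => by
    have h1 := evolutionCLM_apply_one C ψ (x + 1)
    rw [heig] at h1
    simpa using h1
  have hcomp : ∀ i, Tendsto (fun x => ψ x i) cofinite (𝓝 0) := fun i => by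
    have h1 := (summable_comp_sq ψ i).tendsto_cofinite_zero
    have h2 := (Real.continuous_sqrt.tendsto 0).comp h1
    refine tendsto_zero_iff_norm_tendsto_zero.2 ?_
    simpa [Function.comp_def, Real.sqrt_sq (norm_nonneg _)] using h2
  have hinj : Tendsto (fun n : ℕ => (n : ℤ)) atTop cofinite := by
    rw [← Nat.cofinite_eq_atTop]
    exact Nat.cast_injective.tendsto_cofinite
  have hinj' : Tendsto (fun n : ℕ => (n : ℤ) - 1) atTop cofinite := by
    rw [← Nat.cofinite_eq_atTop]
    exact ((sub_left_injective (b := (1 : ℤ))).comp Nat.cast_injective).tendsto_cofinite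
  obtain ⟨n, hn⟩ := exists_eq_zero_of_summable_perturbation (T₀ := transferCLM A z) hκ hκ' hne
    (transferCLM_quadratic ha hz0 hprod hsum)
    (φ := fun n : ℕ => (ψ ((n : ℤ) - 1) 0, ψ n 1))
    (e := fun n : ℕ => (2 / δ + 1) * (‖A 0 0‖⁻¹ + 1) *
      maxNorm ((C n : Matrix (Fin 2) (Fin 2) ℂ) - A))
    (fun n => mul_nonneg (by positivity) (maxNorm_nonneg _)) (hsummable.mul_left _)
    (fun n => norm_sub_transferCLM_le hz ha hδ (hC n)
      (by simpa using eq0 n) (by simpa using eq1 n))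
    (((hcomp 0).comp hinj').prodMk_nhds ((hcomp 1).comp hinj))
  -- A zero of the transfer recursion spreads in both directions.
  have hC0 : ∀ x, C x 0 0 ≠ 0 := fun x => norm_pos_iff.1 (hδ.trans_le (hC x))
  have hC1 : ∀ x, C x 1 1 ≠ 0 := fun x => norm_pos_iff.1 (by
    rw [← norm_zero_zero_eq_norm_one_one]; exact hδ.trans_le (hC x))
  have hall : ∀ x : ℤ, ψ (x - 1) 0 = 0 ∧ ψ x 1 = 0 := by
    intro x
    induction x using Int.inductionOn' (b := (n : ℤ)) with
    | zero => exact ⟨congrArg Prod.fst hn, congrArg Prod.snd hn⟩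
    | succ k _ ih =>
      have h0 : ψ k 0 = 0 := by
        have h1 := eq0 k
        rw [ih.1, ih.2] at h1
        simpa [hC0] using h1.symm
      have h1 := eq1 k
      rw [h0, ih.2] at h1
      exact ⟨by rwa [add_sub_cancel_right], by simpa [hz0] using h1⟩
    | pred k _ ih =>
      have h1 := eq1 (k - 1)
      rw [sub_add_cancel, ih.1, ih.2] at h1
      have h2 : ψ (k - 1) 1 = 0 := by simpa [hC1] using h1.symm
      have h3 := eq0 (k - 1)
      rw [ih.1, h2] at h3
      exact ⟨by simpa [hz0] using h3, h2⟩
  refine hψ ?_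
  ext x i
  fin_cases i
  · simpa using (hall (x + 1)).1
  · simpa using (hall x).2

/-! ### The limit coin and its walk -/

theorem limitCoin_mem_unitaryGroup {p q : ℝ} (hpq : p ^ 2 + q ^ 2 = 1) (α β γ : ℝ) :
    limitCoin p q α β γ ∈ Matrix.unitaryGroup (Fin 2) ℂ := by
  have hpq' : (p : ℂ) ^ 2 + (q : ℂ) ^ 2 = 1 := by exact_mod_cast congrArg Complex.ofReal hpq
  have e1 : ∀ r : ℝ, Complex.exp (Complex.I * r) * Complex.exp (-(Complex.I * r)) = 1 := by
    intro r; rw [← Complex.exp_add, add_neg_cancel, Complex.exp_zero]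
  rw [Matrix.mem_unitaryGroup_iff]
  have hα := e1 α
  have hβ := e1 β
  have hγ := e1 γ
  have f1 : Complex.exp (-Complex.I * (β - γ)) =
      Complex.exp (-(Complex.I * β)) * Complex.exp (Complex.I * γ) := by
    rw [← Complex.exp_add]; congr 1; ring
  have f2 : Complex.exp (-Complex.I * (α - γ)) =
      Complex.exp (-(Complex.I * α)) * Complex.exp (Complex.I * γ) := by
    rw [← Complex.exp_add]; congr 1; ring
  have conj1 : ∀ r : ℝ, (starRingEnd ℂ) (Complex.exp (Complex.I * r)) =
      Complex.exp (-(Complex.I * r)) := fun r => by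
    rw [← Complex.exp_conj]; simp
  have conj2 : ∀ r : ℝ, (starRingEnd ℂ) (Complex.exp (-(Complex.I * r))) =
      Complex.exp (Complex.I * r) := fun r => by
    rw [← Complex.exp_conj]; simp
  ext i j
  fin_cases i <;> fin_cases j <;>
    simp only [limitCoin, f1, f2, Matrix.mul_apply, Fin.sum_univ_two, Matrix.star_apply,
      Matrix.of_apply, Matrix.cons_val', Matrix.cons_val_zero, Matrix.cons_val_one,
      Matrix.cons_val_fin_one, Fin.zero_eta, Fin.mk_one, Complex.star_def, map_mul, map_neg,
      Complex.conj_ofReal, conj1, conj2, Matrix.one_apply, if_true, if_false, zero_ne_one,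
      one_ne_zero]
  · linear_combination (p : ℂ) ^ 2 * hα + (q : ℂ) ^ 2 * hβ + hpq'
  · ring
  · ring
  · linear_combination Complex.exp (Complex.I * γ) * Complex.exp (-(Complex.I * γ)) *
      ((q : ℂ) ^ 2 * hβ + (p : ℂ) ^ 2 * hα + hpq') + hγ

theorem det_limitCoin {p q : ℝ} (hpq : p ^ 2 + q ^ 2 = 1) (α β γ : ℝ) :
    (limitCoin p q α β γ).det = Complex.exp (Complex.I * γ) := by
  have hpq' : (p : ℂ) ^ 2 + (q : ℂ) ^ 2 = 1 := by exact_mod_cast congrArg Complex.ofReal hpq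
  have h : ∀ r : ℝ, Complex.exp (Complex.I * r) * Complex.exp (-Complex.I * (r - γ)) =
      Complex.exp (Complex.I * γ) := fun r => by
    rw [← Complex.exp_add]; congr 1; ring
  rw [limitCoin, Matrix.det_fin_two_of]
  linear_combination (p : ℂ) ^ 2 * h α + (q : ℂ) ^ 2 * h β + Complex.exp (Complex.I * γ) * hpq'

/-- Off the arcs of the limit coin `A` the spectrum is discrete: there the constant walk minus `z`
is bounded below, and the walk is a compact perturbation of the constant walk. -/
theorem mem_discreteSpectrum_of_lt {C : ℤ → Matrix.unitaryGroup (Fin 2) ℂ}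
    {A : Matrix.unitaryGroup (Fin 2) ℂ}
    (h : Tendsto (fun x => maxNorm ((C x : Matrix (Fin 2) (Fin 2) ℂ) - A)) cofinite (𝓝 0))
    {z : ℂ} (hz : z ∈ spectrum ℂ (evolutionCLM C))
    (hlt : ‖A 0 0‖ + ‖A 1 1‖ < ‖z ^ 2 + (A : Matrix (Fin 2) (Fin 2) ℂ).det‖) :
    z ∈ discreteSpectrum (evolutionCLM C) := by
  have hU := evolutionCLM_mem_unitary C
  have hz1 : ‖z‖ = 1 := by simpa using spectrum.subset_circle_of_unitary hU hz
  refine mem_discreteSpectrum_of_compact hU hz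
    (approxEigenvectorsCompact_of_compact_sub (isCompactOperator_evolutionCLM_sub h)
      (half_pos (sub_pos.2 hlt)) fun v => ?_)
  linarith [norm_sq_add_det_mul_norm_le A hz1 v]

theorem exp_neg_mul_sqrt_le {ρ : ℝ} (hρ : 0 < ρ) (x : ℝ) :
    Real.exp (-ρ * Real.sqrt (1 + x ^ 2)) ≤ Real.exp (-ρ * |x|) := by
  have h : |x| ≤ Real.sqrt (1 + x ^ 2) := Real.abs_le_sqrt (by linarith)
  exact Real.exp_le_exp.2 (by nlinarith)

theorem summable_exp_neg_mul_abs {ρ : ℝ} (hρ : 0 < ρ) :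
    Summable fun x : ℤ => Real.exp (-ρ * |(x : ℝ)|) := by
  have h : Summable fun n : ℕ => Real.exp (-ρ * n) := by
    simpa only [mul_comm (-ρ)] using Real.summable_exp_nat_mul_iff.2 (neg_lt_zero.2 hρ)
  refine Summable.of_nat_of_neg ?_ ?_
  · simpa using h
  · simpa using h

end QuantumWalk

end

/-! ### Essential spectrum and embedded eigenvalues -/

open QuantumWalk

theorem theorem1p2 (p q α β γ : ℝ)
    (hp : p ∈ Set.Ioc (0 : ℝ) 1) (hq : q ∈ Set.Icc (0 : ℝ) 1) (hpq : p ^ 2 + q ^ 2 = 1)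
    (hα : α ∈ Set.Ico 0 (2 * Real.pi)) (hβ : β ∈ Set.Ico 0 (2 * Real.pi))
    (hγ : γ ∈ Set.Ico 0 (2 * Real.pi))
    (C : ℤ → Matrix.unitaryGroup (Fin 2) ℂ)
    (hdefect : ∃ δ : ℝ, 0 < δ ∧ ∀ x : ℤ, δ ≤ ‖C x 0 0‖)
    (hexp : ∃ ρ M : ℝ, 0 < ρ ∧ 0 < M ∧ ∀ x : ℤ,
      QuantumWalk.maxNorm
          ((C x : Matrix (Fin 2) (Fin 2) ℂ) - QuantumWalk.limitCoin p q α β γ) ≤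
        M * Real.exp (-ρ * Real.sqrt (1 + (x : ℝ) ^ 2))) :
    QuantumWalk.essentialSpectrum (QuantumWalk.evolutionCLM C) =
        {z : ℂ | ∃ θ ∈ QuantumWalk.arcAngles p γ, z = Complex.exp (Complex.I * θ)} ∧
      ∀ z ∈ QuantumWalk.essentialSpectrum (QuantumWalk.evolutionCLM C) \
          QuantumWalk.thresholds C p γ,
        ¬ QuantumWalk.IsEigenvalue (QuantumWalk.evolutionCLM C) z := by
  obtain ⟨hp0, hp1⟩ := hp
  obtain ⟨δ, hδ, hC⟩ := hdefect
  obtain ⟨ρ, M, hρ, hM, hexp⟩ := hexp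
  set A : Matrix.unitaryGroup (Fin 2) ℂ :=
    ⟨limitCoin p q α β γ, limitCoin_mem_unitaryGroup hpq α β γ⟩
  have hA00 : A 0 0 = (p : ℂ) * Complex.exp (Complex.I * α) := rfl
  have hA11 : A 1 1 = (p : ℂ) * Complex.exp (-Complex.I * (α - γ)) := rfl
  have hdet : (A : Matrix (Fin 2) (Fin 2) ℂ).det = Complex.exp (Complex.I * γ) :=
    det_limitCoin hpq α β γ
  have hn00 : ‖A 0 0‖ = p := by
    rw [hA00, norm_mul, Complex.norm_exp_I_mul_ofReal, Complex.norm_real,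
      Real.norm_of_nonneg hp0.le, mul_one]
  have hn11 : ‖A 1 1‖ = p := by rw [← norm_zero_zero_eq_norm_one_one, hn00]
  have ha : A 0 0 ≠ 0 := norm_pos_iff.1 (by rw [hn00]; exact hp0)
  have hsum : Summable fun x => maxNorm ((C x : Matrix (Fin 2) (Fin 2) ℂ) - A) :=
    ((summable_exp_neg_mul_abs hρ).mul_left M).of_nonneg_of_le (fun x => maxNorm_nonneg _)
      fun x => (hexp x).trans (mul_le_mul_of_nonneg_left (exp_neg_mul_sqrt_le hρ x) hM.le)
  have hlim := hsum.tendsto_cofinite_zero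
  have hlim' : Tendsto (fun x => maxNorm ((C x : Matrix (Fin 2) (Fin 2) ℂ) - A)) atTop (𝓝 0) :=
    hlim.mono_left atTop_le_cofinite
  have hspec : ∀ θ ∈ arcAngles p γ,
      Complex.exp (Complex.I * θ) ∈ spectrum ℂ (evolutionCLM C) := by
    intro θ hθ
    obtain ⟨hz, hle⟩ := (exists_arcAngle_iff hp0 hp1 _).1 ⟨θ, hθ, rfl⟩
    obtain ⟨κ, κ', hκ, -, hprod, hdisp, -⟩ := exists_waveNumbers (α := α) hp0 hz hle
    rw [← hA00, ← hA11] at hprod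
    rw [← hA00, ← hdet, Matrix.det_fin_two] at hdisp
    refine mem_spectrum_of_dispersion hlim' hz hκ ?_
    linear_combination κ * hdisp * (-1) + hprod * Complex.exp (Complex.I * θ)
  have hess : essentialSpectrum (evolutionCLM C) =
      {z : ℂ | ∃ θ ∈ arcAngles p γ, z = Complex.exp (Complex.I * θ)} := by
    ext z
    constructor
    · rintro ⟨hz, hdisc⟩
      have hz1 : ‖z‖ = 1 := by
        simpa using spectrum.subset_circle_of_unitary (evolutionCLM_mem_unitary C) hz
      refine (exists_arcAngle_iff hp0 hp1 z).2 ⟨hz1, ?_⟩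
      by_contra! hlt
      refine hdisc (mem_discreteSpectrum_of_lt hlim hz ?_)
      rw [hn00, hn11, hdet]
      linarith
    · rintro ⟨θ, hθ, rfl⟩
      refine ⟨hspec θ hθ, ?_⟩
      rintro ⟨-, -, ε, hε, hiso⟩
      obtain ⟨θ', hθ', hdist, hne⟩ := exists_arcAngle_near hp0 hθ hε
      exact hne (hiso _ (hspec θ' hθ') hdist)
  refine ⟨hess, ?_⟩
  rintro z ⟨hz, hthr⟩
  obtain ⟨hz1, hle⟩ := (exists_arcAngle_iff hp0 hp1 z).1 (hess ▸ hz)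
  obtain ⟨κ, κ', hκ, hκ', hprod, hdisp, hne⟩ := exists_waveNumbers (α := α) hp0 hz1 hle
  refine not_isEigenvalue_of_dispersion ha hδ hC
    (hsum.comp_injective Nat.cast_injective) hz1 hκ hκ'
    (hne fun heq => hthr ⟨hz, exists_thresholdAngle hz1 heq⟩) hprod ?_
  rw [hdet]
  exact hdisp
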